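/- Vinyl graphs. A vinyl graph is a closed, oriented, trivalent plane graph obtained by stacking split vertices (one edge below, two edges above) and merge vertices (two edges below, one above) together with vertical strands, and closing up the strands around an annulus; its edges $e$ carry labels $\ell(e)\in\mathbb{N}_{>0}$ that add up at each vertex. For a split vertex $v$ write $e^l(v), e^r(v)$ for its upper left and upper right edges. The level $n$ is the sum of the labels at a fixed height, and $t_\Gamma=\sum_{v\text{ split}}\ell(e^l(v))\,\ell(e^r(v))$. State space. A decoration $d$ of $\Gamma$ assigns to each edge $e$ a homogeneous symmetric polynomial $d(e)\in\mathbb{Z}[x_1,\dots,x_{\ell(e)}]^{S_{\ell(e)}}$; the decorated graph $\Gamma^d$ is the element $\bigotimes_e d(e)$ of the algebra $\mathscr{D}(\Gamma)=\bigotimes_{e}\mathbb{Z}[x_1,\dots,x_{\ell(e)}]^{S_{\ell(e)}}$. A coloring $c$ assigns to each edge $e$ a set $c(e)\subseteq\{1,\dots,n\}$ with $\ell(e)$ elements such that at each vertex the set of the thick edge is the union of the two others, and such that the sets at a fixed height cover $\{1,\dots,n\}$. Let $$\langle\Gamma^d\rangle_\infty=\sum_{c}\frac{\prod_{e}d(e)\big((x_i)_{i\in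 c(e)}\big)}{\prod_{v\text{ split}}\ \prod_{i\in c(e^l(v)),\,j\in c(e^r(v))}(x_i-x_j)},$$ extended linearly to $\mathscr{D}(\Gamma)$. If its values are polynomials in $x_1,\dots,x_n$, let $\langle\cdot\rangle_1$ be their value at $(0,\dots,0)$, and let $\mathscr{S}_1(\Gamma)$ be the quotient of $\mathscr{D}(\Gamma)$ by the submodule of all $x$ with $\langle x\cdot\Gamma^d\rangle_1=0$ for every decoration $d$. The degree of $\Gamma^d$ is $2\sum_e\deg d(e)-t_\Gamma$, and the part of degree $m$ of $\mathscr{S}_1(\Gamma)$ is the span of the classes of the decorated graphs of degree $m$. The d.u.r. set of $\Gamma$ consists of the decorated graphs $\Gamma^d$ such that, for each split vertex $v$ with $a=\ell(e^r(v))$ and $b=\ell(e^l(v))$, the polynomial $d(e^r(v))$ is the Schur polynomial $\det(x_i^{\mu_j+a-j})/\det(x_i^{a-j})$ in $a$ variables for some integers $b\ge\mu_1\ge\dots\ge\mu_a\ge0$, and $d(e)=1$ for all other edges $e$. (For $a=1$: $d(e^r(v))=x_1^{i}$ with $0\le i\le b$.) The graphs. For $k,\ell\in\mathbb{N}$ let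 $\Gamma_{k,\ell}$ be the closure of the following open graph on strands $0,1,\dots,\ell+1$, where strand $0$ has label $k$ and all others have label $1$: from bottom to top, for $j=0,1,\dots,\ell$, there is a dumbbell that merges the strands $j$ and $j+1$ into one edge and splits this edge again into strands with the same labels as before. When $k=0$, the edges with label $0$ are removed; thus $\Gamma_{0,\ell}=\Theta_\ell$ is the closure of $\ell+1$ strands with label $1$ and a staircase of $\ell$ dumbbells, one on each pair of adjacent strands. Theorem. For all $k,\ell\in\mathbb{N}$, the $\infty$-evaluation of $\Gamma=\Gamma_{k,\ell}$ takes polynomial values, $\mathscr{S}_1(\Gamma)$ is the direct sum of its parts of degree $m\in\mathbb{Z}$, and the classes of the elements of the d.u.r. set, which are homogeneous, are pairwise distinct and form a $\mathbb{Z}$-basis of the graded $\mathbb{Z}$-module $\mathscr{S}_1(\Gamma_{k,\ell})$. In particular, this holds for $\Theta_\ell=\Gamma_{0,\ell}$, for all $\ell\in\mathbb{N}$. -/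

import Mathlib

open scoped TensorProduct

/-- The vertices of a trivalent labelled graph with split and merge vertices, read from left
to right and from bottom to top. `Sum.inl v` is a split vertex (one edge `splitIn v` below, two
edges `splitLeft v`, `splitRight v` above), `Sum.inr v` is a merge vertex (two edges
`mergeLeft v`, `mergeRight v` below, one edge `mergeOut v` above). -/
structure TrivalentData (Edge Split Merge : Type) where
  splitIn : Split → Edge
  splitLeft : Split → Edge
  splitRight : Split → Edge
  mergeLeft : Merge → Edge
  mergeRight : Merge → Edge
  mergeOut : Merge → Edge

/-- `T.Stack r w s`: starting with the vertical edges `r` (listed from left to right) and gluing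
on top of each other, from bottom to top, one layer for each vertex in the list `w` (a layer
consists of that vertex and of vertical strands), one ends up with the edges `s`. The edges
leaving a vertex are required not to occur at the height just below that vertex. -/
inductive TrivalentData.Stack {Edge Split Merge : Type}
    (T : TrivalentData Edge Split Merge) :
    List Edge → List (Split ⊕ Merge) → List Edge → Prop
  | nil (r : List Edge) : TrivalentData.Stack T r [] r
  | split (A B s : List Edge) (w : List (Split ⊕ Merge)) (v : Split) :
      T.splitLeft v ∉ A ++ T.splitIn v :: B → T.splitRight v ∉ A ++ T.splitIn v :: B →
      TrivalentData.Stack T (A ++ T.splitLeft v :: T.splitRight v :: B) w s →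
      TrivalentData.Stack T (A ++ T.splitIn v :: B) (Sum.inl v :: w) s
  | merge (A B s : List Edge) (w : List (Split ⊕ Merge)) (v : Merge) :
      T.mergeOut v ∉ A ++ T.mergeLeft v :: T.mergeRight v :: B →
      TrivalentData.Stack T (A ++ T.mergeOut v :: B) w s →
      TrivalentData.Stack T (A ++ T.mergeLeft v :: T.mergeRight v :: B) (Sum.inr v :: w) s

/-- The edge-ends leaving the vertices (pointing upwards). -/
def TrivalentData.outgoing {Edge Split Merge : Type} (T : TrivalentData Edge Split Merge) :
    Split ⊕ Split ⊕ Merge → Edge :=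
  Sum.elim T.splitLeft (Sum.elim T.splitRight T.mergeOut)

/-- A closed vinyl graph. It is obtained by stacking split and merge vertices (`word`, from
bottom to top) over the edges `base`, and by closing up the strands: the edges on top are again
the list `base`. Edges carry positive labels which add up at each vertex. -/
structure VinylGraph where
  Edge : Type
  Split : Type
  Merge : Type
  [fintypeEdge : Fintype Edge]
  [decEqEdge : DecidableEq Edge]
  [fintypeSplit : Fintype Split]
  [fintypeMerge : Fintype Merge]
  data : TrivalentData Edge Split Merge
  label : Edge → ℕ
  label_pos : ∀ e, 0 < label e
  label_split : ∀ v, label (data.splitIn v) = label (data.splitLeft v) + label (data.splitRight v)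
  label_merge : ∀ v, label (data.mergeOut v) = label (data.mergeLeft v) + label (data.mergeRight v)
  /-- the edges at the height where the graph is closed up, from left to right -/
  base : List Edge
  word : List (Split ⊕ Merge)
  base_nodup : base.Nodup
  /-- every vertex is used exactly once -/
  word_nodup : word.Nodup
  mem_word : ∀ v, v ∈ word
  stack : data.Stack base word base
  /-- each edge starts at no more than one vertex -/
  outgoing_injective : Function.Injective data.outgoing
  /-- each edge occurs in the picture -/
  edge_occurs : ∀ e, e ∈ base ∨ e ∈ Set.range data.outgoing
  /-- the sum of the labels of the edges at a fixed height -/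
  level : ℕ
  level_eq : (base.map label).sum = level

namespace VinylGraph

attribute [instance] VinylGraph.fintypeEdge VinylGraph.decEqEdge VinylGraph.fintypeSplit
  VinylGraph.fintypeMerge

noncomputable section

variable (Γ : VinylGraph) (R : Type) [CommRing R]

/-- A decoration: a homogeneous symmetric polynomial in `ℓ(e)` variables for each edge `e`. -/
structure Decoration where
  poly : (e : Γ.Edge) → MvPolynomial.symmetricSubalgebra (Fin (Γ.label e)) R
  homogeneous : ∀ e, ∃ m, (poly e : MvPolynomial (Fin (Γ.label e)) R).IsHomogeneous m

/-- `t_Γ`, the sum of `a b` over all split vertices with labels `a, b, a + b`. -/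
def splitWeight : ℕ := ∑ v : Γ.Split, Γ.label (Γ.data.splitLeft v) * Γ.label (Γ.data.splitRight v)

variable {Γ R} in
/-- The degree `2 deg(d) - t_Γ` of the decorated graph `Γ^d`. -/
def Decoration.degree (d : Γ.Decoration R) : ℤ :=
  2 * ∑ e, ((d.poly e : MvPolynomial (Fin (Γ.label e)) R).totalDegree : ℤ) - Γ.splitWeight

variable {R} in
/-- `p` is the Schur polynomial in `a` variables with exponents `μ_1 ≥ … ≥ μ_a`, by the
bialternant formula `p · det (x_i^{a-j}) = det (x_i^{μ_j+a-j})`. Here `μ_j` is the length of the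
`j`-th column of the Young diagram, so that a diagram with one row of `i` boxes gives the
elementary polynomial `e_i`, and one with a single column of `i` boxes gives `x_1^i` for `a = 1`. -/
def IsSchur {a : ℕ} (μ : Fin a → ℕ) (p : MvPolynomial (Fin a) R) : Prop :=
  p * (Matrix.of fun i j : Fin a => (MvPolynomial.X i : MvPolynomial (Fin a) R) ^
      (j.rev : ℕ)).det =
    (Matrix.of fun i j : Fin a => (MvPolynomial.X i : MvPolynomial (Fin a) R) ^
      (μ j + (j.rev : ℕ))).det

/-- The d.u.r. set: the decoration of the right edge of each split vertex, with labels `a` on the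
right and `b` on the left, is the Schur polynomial of a Young diagram with at most `a` columns
and at most `b` rows; all other edges have the trivial decoration. -/
def dur : Set (Γ.Decoration R) :=
  {d | (∀ v, ∃ μ : Fin (Γ.label (Γ.data.splitRight v)) → ℕ, Antitone μ ∧
          (∀ j, μ j ≤ Γ.label (Γ.data.splitLeft v)) ∧
          IsSchur μ (d.poly (Γ.data.splitRight v) : MvPolynomial _ R)) ∧
        ∀ e, (∀ v, e ≠ Γ.data.splitRight v) → d.poly e = 1}

/-- `𝒟(Γ) = ⨂_e R[x_1, …, x_{ℓ(e)}]^{S_{ℓ(e)}}`, a commutative `R`-algebra. -/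
def DecoratedSpace : Type :=
  ⨂[R] e : Γ.Edge, MvPolynomial.symmetricSubalgebra (Fin (Γ.label e)) R

instance : CommRing (Γ.DecoratedSpace R) :=
  inferInstanceAs (CommRing
    (⨂[R] e : Γ.Edge, MvPolynomial.symmetricSubalgebra (Fin (Γ.label e)) R))

instance : Algebra R (Γ.DecoratedSpace R) :=
  inferInstanceAs (Algebra R
    (⨂[R] e : Γ.Edge, MvPolynomial.symmetricSubalgebra (Fin (Γ.label e)) R))

variable {Γ R} in
/-- The decorated graph `Γ^d` as an element of `𝒟(Γ)`. -/
def Decoration.toSpace (d : Γ.Decoration R) : Γ.DecoratedSpace R :=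
  PiTensorProduct.tprod R d.poly

/-- A coloring of `Γ` by `{1, …, n}`, where `n` is the level of `Γ`. The union of the colors over
a fixed height does not depend on the height; it is taken at the height of `base`. -/
structure IsColoring (c : Γ.Edge → Finset (Fin Γ.level)) : Prop where
  card_eq : ∀ e, (c e).card = Γ.label e
  split : ∀ v, c (Γ.data.splitIn v) = c (Γ.data.splitLeft v) ∪ c (Γ.data.splitRight v)
  merge : ∀ v, c (Γ.data.mergeOut v) = c (Γ.data.mergeLeft v) ∪ c (Γ.data.mergeRight v)
  cover : ∀ i, ∃ e ∈ Γ.base, i ∈ c e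

def Coloring : Type := {c : Γ.Edge → Finset (Fin Γ.level) // Γ.IsColoring c}

instance : Fintype Γ.Coloring := by
  classical exact inferInstanceAs (Fintype {c // Γ.IsColoring c})

variable {Γ}

/-- `p ↦ p(x_{i_1}, …, x_{i_{ℓ(e)}})` where `c(e) = {i_1 < … < i_{ℓ(e)}}`. -/
def Coloring.substitute (c : Γ.Coloring) (e : Γ.Edge) :
    MvPolynomial.symmetricSubalgebra (Fin (Γ.label e)) R →ₐ[R] MvPolynomial (Fin Γ.level) R :=
  (MvPolynomial.rename ((c.1 e).orderEmbOfFin (c.2.card_eq e))).comp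
    (MvPolynomial.symmetricSubalgebra (Fin (Γ.label e)) R).val

/-- The linear extension to `𝒟(Γ)` of `Γ^d ↦ P(Γ^d, c) = ∏_e d_c(e)`; it is multiplicative. -/
def Coloring.numerator (c : Γ.Coloring) :
    Γ.DecoratedSpace R →ₐ[R] MvPolynomial (Fin Γ.level) R :=
  PiTensorProduct.liftAlgHom
    ((MultilinearMap.mkPiAlgebra R Γ.Edge (MvPolynomial (Fin Γ.level) R)).compLinearMap
      fun e => (c.substitute R e).toLinearMap)
    (by simp)
    (fun x y => by simp [Finset.prod_mul_distrib])

/-- `Q(Γ, c)`, a product over the split vertices. -/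
def Coloring.denominator (c : Γ.Coloring) : MvPolynomial (Fin Γ.level) R :=
  ∏ v : Γ.Split, ∏ i ∈ c.1 (Γ.data.splitLeft v), ∏ j ∈ c.1 (Γ.data.splitRight v),
    (MvPolynomial.X i - MvPolynomial.X j)

variable (Γ)

/-- The field `R(x_1, …, x_n)`. -/
abbrev RatFunctions : Type := FractionRing (MvPolynomial (Fin Γ.level) R)

/-- The inclusion of `R[x_1, …, x_n]` in `R(x_1, …, x_n)`. -/
def polyToRat : MvPolynomial (Fin Γ.level) R →ₗ[R] Γ.RatFunctions R :=
  (IsScalarTower.toAlgHom R (MvPolynomial (Fin Γ.level) R) (Γ.RatFunctions R)).toLinearMap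

variable [IsDomain R]

/-- The `∞`-evaluation, extended linearly to `𝒟(Γ)`. -/
def evalInfty : Γ.DecoratedSpace R →ₗ[R] Γ.RatFunctions R :=
  ∑ c : Γ.Coloring,
    (LinearMap.mulLeft R (Γ.polyToRat R (c.denominator R))⁻¹) ∘ₗ Γ.polyToRat R ∘ₗ (c.numerator R).toLinearMap

/-- The rational functions which are polynomials with value `0` at `(0, …, 0)`. -/
def vanishingAtZero : Submodule R (Γ.RatFunctions R) :=
  (LinearMap.ker (MvPolynomial.aeval (0 : Fin Γ.level → R)).toLinearMap).map (Γ.polyToRat R)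

/-- The kernel of `(· , Γ^d)_1 : 𝒟(Γ) → R`. The `1`-evaluation of `x` is the value at `0` of the
polynomial `⟨x⟩_∞`, so this consists of the `x` such that `⟨x · Γ^d⟩_∞` is a polynomial that
vanishes at `0`. -/
def pairingKer (d : Γ.Decoration R) : Submodule R (Γ.DecoratedSpace R) :=
  (Γ.vanishingAtZero R).comap (Γ.evalInfty R ∘ₗ LinearMap.mulRight R d.toSpace)

/-- The state space `𝒮_1(Γ) = 𝒟(Γ) / ⋂_d ker (· , Γ^d)_1`. -/
abbrev StateSpace : Type :=
  Γ.DecoratedSpace R ⧸ (⨅ d : Γ.Decoration R, Γ.pairingKer R d)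

variable {Γ R}

/-- The class of `Γ^d` in `𝒮_1(Γ)`. -/
def Decoration.toState (d : Γ.Decoration R) : Γ.StateSpace R :=
  Submodule.Quotient.mk d.toSpace

variable (Γ R)

/-- The degree `m` part of `𝒮_1(Γ)`, spanned by the decorated graphs of degree `m`. -/
def gradedPart (m : ℤ) : Submodule R (Γ.StateSpace R) :=
  Submodule.span R {x | ∃ d : Γ.Decoration R, d.degree = m ∧ d.toState = x}

/-- The d.u.r. set is a basis of the graded `R`-module `𝒮_1(Γ)`. The first two fields say that
`𝒮_1(Γ)` is well defined as a graded module: the `∞`-evaluation takes values in the polynomials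
(so that the `1`-evaluation makes sense), and `𝒮_1(Γ)` is the direct sum of its graded parts. -/
structure IsDurGraph : Prop where
  evalInfty_mem : ∀ x, Γ.evalInfty R x ∈ LinearMap.range (Γ.polyToRat R)
  isInternal : DirectSum.IsInternal (Γ.gradedPart R)
  homogeneous : ∀ d ∈ Γ.dur R, d.toState ∈ Γ.gradedPart R d.degree
  linearIndependent : LinearIndependent R fun d : Γ.dur R => d.1.toState
  span_eq_top : Submodule.span R (Set.range fun d : Γ.dur R => d.1.toState) = ⊤

end

/-! ### The graphs `Γ_{k,ℓ}` and `Θ_ℓ` -/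

/-- The closure of a single vertical strand with label `1`. -/
@[reducible]
def circle : VinylGraph where
  Edge := Unit
  Split := Empty
  Merge := Empty
  data := ⟨Empty.elim, Empty.elim, Empty.elim, Empty.elim, Empty.elim, Empty.elim⟩
  label _ := 1
  label_pos _ := Nat.one_pos
  label_split v := v.elim
  label_merge v := v.elim
  base := [()]
  word := []
  base_nodup := List.nodup_singleton _
  word_nodup := List.nodup_nil
  mem_word v := by rcases v with v | v <;> exact v.elim
  stack := TrivalentData.Stack.nil _
  outgoing_injective v := by rcases v with v | v | v <;> exact v.elim
  edge_occurs _ := Or.inl (List.mem_singleton.2 rfl)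
  level := 1
  level_eq := rfl

/-- Edges of the chain of `ℓ + 1` dumbbells numbered `0, …, ℓ` from bottom to top: `thick j` is the
middle edge of dumbbell `j`, and `left j`, `right j` are the edges leaving its split vertex on the
left and on the right. -/
inductive ChainEdge (ℓ : ℕ)
  | thick (j : Fin (ℓ + 1))
  | left (j : Fin (ℓ + 1))
  | right (j : Fin (ℓ + 1))
  deriving DecidableEq, Fintype

/-- The vertices and edges of the closure of the open graph on strands `0, 1, …, ℓ + 1` which
consists, from bottom to top, of dumbbells `0, …, ℓ`, where dumbbell `j` merges the strands `j` and
`j + 1` to a single edge and splits this edge again. Its lower left edge is the upper right edge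
of dumbbell `j - 1` (for `j = 0` it is its own upper left edge, around the annulus), and its lower
right edge is, around the annulus, the upper left edge of dumbbell `j + 1` (for `j = ℓ`, its own
upper right edge). -/
def chainData (ℓ : ℕ) : TrivalentData (ChainEdge ℓ) (Fin (ℓ + 1)) (Fin (ℓ + 1)) where
  splitIn := .thick
  splitLeft := .left
  splitRight := .right
  mergeLeft := Fin.cases (.left 0) fun i => .right i.castSucc
  mergeRight := Fin.lastCases (.right (Fin.last ℓ)) fun i => .left i.succ
  mergeOut := .thick

/-- Labels: strand `0` has label `k`, the strands `1, …, ℓ + 1` have label `1`. -/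
def chainLabel (k ℓ : ℕ) : ChainEdge ℓ → ℕ
  | .thick j => if j = 0 then k + 1 else 2
  | .left j => if j = 0 then k else 1
  | .right _ => 1

def chainBase (ℓ : ℕ) : List (ChainEdge ℓ) :=
  (List.finRange (ℓ + 1)).map .left ++ [.right (Fin.last ℓ)]

def chainWord (ℓ : ℕ) : List (Fin (ℓ + 1) ⊕ Fin (ℓ + 1)) :=
  (List.finRange (ℓ + 1)).flatMap fun j => [Sum.inr j, Sum.inl j]

theorem chainStack_aux (ℓ : ℕ) (m : ℕ) : ∀ j : Fin (ℓ + 1), (j : ℕ) + m = ℓ →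
    (chainData ℓ).Stack
      (((List.finRange (ℓ + 1)).take j).map .left ++ (chainData ℓ).mergeLeft j ::
        (((List.finRange (ℓ + 1)).drop (j + 1)).map .left ++ [.right (Fin.last ℓ)]))
      (((List.finRange (ℓ + 1)).drop j).flatMap fun j => [Sum.inr j, Sum.inl j])
      (chainBase ℓ) := by
  have hdrop : ∀ j : Fin (ℓ + 1), (List.finRange (ℓ + 1)).drop j =
      j :: (List.finRange (ℓ + 1)).drop (j + 1) := by
    intro j
    rw [List.drop_eq_getElem_cons (by simp; omega)]
    simp
  have htake : ∀ j : Fin (ℓ + 1), (List.finRange (ℓ + 1)).take (j + 1) =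
      (List.finRange (ℓ + 1)).take j ++ [j] := by
    intro j
    rw [List.take_succ_eq_append_getElem (by simp; omega)]
    simp
  have hnot : ∀ j : Fin (ℓ + 1), j ∉ (List.finRange (ℓ + 1)).take j := by
    intro j hj
    have := List.nodup_finRange (ℓ + 1)
    rw [← List.take_append_drop j (List.finRange (ℓ + 1)), hdrop] at this
    exact (List.nodup_append.1 this).2.2 j hj j (by simp) rfl
  have hnot' : ∀ (j : Fin (ℓ + 1)) (i : ℕ), (j : ℕ) < i → j ∉ (List.finRange (ℓ + 1)).drop i := by
    intro j i hji hj
    obtain ⟨n, hn, h⟩ := List.mem_iff_getElem.1 hj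
    have := congrArg Fin.val h
    simp at this
    omega
  induction m with
  | zero =>
    intro j hj
    obtain rfl : j = Fin.last ℓ := Fin.ext (by simpa using hj)
    have hd : (List.finRange (ℓ + 1)).drop ((Fin.last ℓ : Fin (ℓ + 1)) + 1 : ℕ) = [] := by simp
    rw [hdrop, hd]
    have hr : (chainData ℓ).mergeRight (Fin.last ℓ) = ChainEdge.right (Fin.last ℓ) := by
      simp [chainData]
    have hb : chainBase ℓ = ((List.finRange (ℓ + 1)).take (Fin.last ℓ : Fin (ℓ + 1))).map .left ++
        [ChainEdge.left (Fin.last ℓ), ChainEdge.right (Fin.last ℓ)] := by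
      have h1 := htake (Fin.last ℓ)
      rw [List.take_of_length_le (by simp)] at h1
      rw [chainBase]
      conv_lhs => rw [h1]
      simp
    simp only [List.map_nil, List.nil_append, List.flatMap_cons, List.flatMap_nil, List.cons_append]
    rw [← hr]
    apply TrivalentData.Stack.merge _ [] _ _ (Fin.last ℓ)
    · rw [hr]
      refine Fin.cases ?_ (fun i => ?_) (Fin.last ℓ) <;> simp [chainData, -List.map_take, -List.map_drop]
    · apply TrivalentData.Stack.split _ [] _ _ (Fin.last ℓ)
      · simpa [chainData, -List.map_take, -List.map_drop] using hnot (Fin.last ℓ)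
      · simp [chainData, -List.map_take, -List.map_drop]
      · rw [hb]
        exact TrivalentData.Stack.nil _
  | succ m ih =>
    intro j hj
    obtain ⟨i, rfl⟩ : ∃ i : Fin ℓ, j = i.castSucc := ⟨⟨j, by omega⟩, rfl⟩
    have hih := ih i.succ (by simp at hj ⊢; omega)
    have hr : (chainData ℓ).mergeRight i.castSucc = ChainEdge.left i.succ := by
      simp [chainData]
    have hl : (chainData ℓ).mergeLeft i.succ = ChainEdge.right i.castSucc := by
      simp [chainData]
    have e1 : ((i.castSucc : Fin (ℓ + 1)) : ℕ) + 1 = (i.succ : Fin (ℓ + 1)) := by simp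
    rw [hdrop, e1, hdrop i.succ]
    simp only [List.map_cons, List.flatMap_cons, List.cons_append, List.nil_append]
    rw [← hr]
    apply TrivalentData.Stack.merge _ _ _ _ i.castSucc
    · rw [hr]
      refine Fin.cases ?_ (fun i => ?_) i.castSucc <;>
        simp [chainData, -List.map_take, -List.map_drop]
    · apply TrivalentData.Stack.split _ _ _ _ i.castSucc
      · have h1 := hnot i.castSucc
        have h2 := hnot' i.castSucc (i.succ + 1) (by simp)
        simp only [Fin.val_castSucc] at h1
        simp [chainData, -List.map_take, -List.map_drop] at h2 ⊢
        exact ⟨h1, h2⟩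
      · simp [chainData, -List.map_take, -List.map_drop]
      · rw [hl, hdrop i.succ, ← e1, htake] at hih
        rw [← e1]
        simpa [chainData] using hih

theorem chainStack (ℓ : ℕ) : (chainData ℓ).Stack (chainBase ℓ) (chainWord ℓ) (chainBase ℓ) := by
  have h := chainStack_aux ℓ ℓ 0 (by simp)
  simpa [chainBase, chainWord, chainData, List.finRange_succ] using h

/-- The graph `Γ_{k,ℓ}` for `k > 0`: the closure of the dumbbells `0, …, ℓ`, the first one on
strands with labels `k` and `1`, the others on strands with labels `1` and `1`. -/
@[reducible]
def chain (k : ℕ) (hk : 0 < k) (ℓ : ℕ) : VinylGraph where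
  Edge := ChainEdge ℓ
  Split := Fin (ℓ + 1)
  Merge := Fin (ℓ + 1)
  data := chainData ℓ
  label := chainLabel k ℓ
  label_pos e := by
    rcases e with j | j | j <;> simp only [chainLabel] <;> (try split_ifs) <;> omega
  label_split j := by
    simp only [chainLabel, chainData]
    split_ifs <;> omega
  label_merge j := by
    have hr : chainLabel k ℓ ((chainData ℓ).mergeRight j) = 1 := by
      refine Fin.lastCases ?_ (fun i => ?_) j <;> simp [chainData, chainLabel]
    rw [hr]
    refine Fin.cases ?_ (fun i => ?_) j <;> simp [chainData, chainLabel]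
  base := chainBase ℓ
  word := chainWord ℓ
  base_nodup := by
    have h : Function.Injective (ChainEdge.left : Fin (ℓ + 1) → ChainEdge ℓ) :=
      fun a b hab => ChainEdge.left.inj hab
    simp [chainBase, List.nodup_append, (List.nodup_finRange (ℓ + 1)).map h]
  word_nodup := by
    refine List.nodup_flatMap.2 ⟨by simp, (List.nodup_finRange _).imp ?_⟩
    intro a b hab
    simp [Function.onFun, hab.symm]
  mem_word v := by
    rcases v with v | v <;> simp [chainWord]
  stack := chainStack ℓ
  outgoing_injective := by
    rintro (a | a | a) (b | b | b) h <;> simp_all [TrivalentData.outgoing, chainData]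
  edge_occurs e := by
    right
    rcases e with j | j | j
    · exact ⟨Sum.inr (Sum.inr j), rfl⟩
    · exact ⟨Sum.inl j, rfl⟩
    · exact ⟨Sum.inr (Sum.inl j), rfl⟩
  level := k + ℓ + 1
  level_eq := by
    simp [chainBase, chainLabel, List.finRange_succ, Function.comp_def, List.map_map]
    omega

/-- The graph `Θ_ℓ`: the closure of `ℓ + 1` strands with label `1` with `ℓ` dumbbells, the `j`-th of
which joins the strands `j` and `j + 1`. -/
def Theta : ℕ → VinylGraph
  | 0 => circle
  | ℓ + 1 => chain 1 Nat.one_pos ℓ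

/-- The graph `Γ_{k,ℓ}`, of level `k + ℓ + 1`. For `k = 0` its leftmost strand and the edge of the
dumbbell `0` attached to it have label `0` and are removed; what is left is the graph `Θ_ℓ`. -/
def Gamma : ℕ → ℕ → VinylGraph
  | 0, ℓ => Theta ℓ
  | k + 1, ℓ => chain (k + 1) k.succ_pos ℓ

end VinylGraph

/-! The lower left edge of dumbbell 0 is its own upper left edge, so each dumbbell in turn returns
the colors of its two strands unchanged. A coloring of the chain with k > 0 is therefore a sequence
b of ℓ + 1 distinct colors, those of the right edges; the other k colors lie on strand 0. Numerators
become polynomials in y_j = x_{b_j} over ℤ[x], and up to a global sign the ∞-evaluation is a sum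
over b of the type `chainSum`. At x = 0 there remains a linear form τ_{ℓ,k} (`chainForm`) on ℤ[y_0,
…, y_ℓ]. The state space is the quotient of this ring by the radical of (f, g) ↦ τ(fg), and the
d.u.r. set becomes the monomials y_0^i ∏ y_j^{ε_j} with i ≤ k and ε_j ≤ 1.

Summing over the first color of a sequence produces complete symmetric polynomials. This gives both
polynomiality and the recursion τ_{ℓ+1,k}(X^i f) = -τ_{ℓ,k+1}(z^i f) + [i > k] · binom(k+ℓ+2, k+1) ·
τ_{ℓ,0}(z^{i-k-1} f), where X is the new variable and z the first variable of f
(`hasConstant_chainSum`).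

The basis is found by induction on ℓ (`isBasisModRadical_adjoinForm`). The radical contains a monic
polynomial in X of degree k + 1, since X is a root of ∏_a (t - x_a) / ∏_j (t - y_j)
(`exists_monic_mem_formRadical`). Let Y run over the basis for τ_{ℓ,0}. The recursion makes the
elements z^i Y (i ≤ k+1) and (X^i - z^i) Y (1 ≤ i ≤ k) independent, by a triangular pairing. The
wanted family X^i z^ε Y spans and has the same size, so it is independent too. Only the nonvanishing
of the binomial coefficient is used, so the argument works over ℤ.

The grading is a degree count: all denominators have degree t_Γ, so decorations of degrees m and n
pair to zero unless m + n = 0. -/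

/-! ### Bases modulo the radical of a linear form on a commutative ring -/

/-- The radical of the bilinear form `(f, g) ↦ τ (f g)`. -/
def formRadical {P : Type*} [CommRing P] (τ : P →ₗ[ℤ] ℤ) : Ideal P where
  carrier := {f | ∀ g, τ (f * g) = 0}
  add_mem' hf hg h := by rw [add_mul, map_add, hf, hg, add_zero]
  zero_mem' h := by rw [zero_mul, map_zero]
  smul_mem' c f hf g := by
    rw [smul_eq_mul, show c * f * g = f * (c * g) by ring]
    exact hf _

theorem mem_formRadical {P : Type*} [CommRing P] {τ : P →ₗ[ℤ] ℤ} {f : P} :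
    f ∈ formRadical τ ↔ ∀ g, τ (f * g) = 0 := Iff.rfl

/-- The family `b` induces a basis of the quotient of `P` by the radical of `τ`. -/
structure IsBasisModRadical {P ι : Type*} [CommRing P] (τ : P →ₗ[ℤ] ℤ) (b : ι → P) : Prop where
  linearIndependent : LinearIndependent ℤ fun i => Ideal.Quotient.mk (formRadical τ) (b i)
  span_eq_top : Submodule.span ℤ (Set.range fun i => Ideal.Quotient.mk (formRadical τ) (b i)) = ⊤

namespace IsBasisModRadical

variable {P ι : Type*} [CommRing P] {τ : P →ₗ[ℤ] ℤ} {b : ι → P}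

theorem exists_sub_mem [Fintype ι] (h : IsBasisModRadical τ b) (f : P) :
    ∃ c : ι → ℤ, f - ∑ i, c i • b i ∈ formRadical τ := by
  have hf : Ideal.Quotient.mk (formRadical τ) f ∈
      Submodule.span ℤ (Set.range fun i => Ideal.Quotient.mk (formRadical τ) (b i)) := by
    rw [h.span_eq_top]; trivial
  obtain ⟨c, hc⟩ := (Submodule.mem_span_range_iff_exists_fun ℤ).1 hf
  refine ⟨c, ?_⟩
  rw [← Ideal.Quotient.eq, ← hc, map_sum]
  simp

theorem eq_zero_of_sum_mem [Fintype ι] (h : IsBasisModRadical τ b) {c : ι → ℤ}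
    (hc : ∑ i, c i • b i ∈ formRadical τ) (i : ι) : c i = 0 := by
  refine Fintype.linearIndependent_iff.1 h.linearIndependent c ?_ i
  rw [← Ideal.Quotient.eq_zero_iff_mem] at hc
  rw [← hc, map_sum]
  simp

theorem comp_equiv {κ : Type*} (h : IsBasisModRadical τ b) (e : κ ≃ ι) :
    IsBasisModRadical τ (b ∘ e) where
  linearIndependent := h.linearIndependent.comp e e.injective
  span_eq_top := by
    rw [← h.span_eq_top, ← e.surjective.range_comp (fun i => Ideal.Quotient.mk _ (b i))]
    rfl

end IsBasisModRadical

/-- A generating family whose cardinality is that of a linearly independent family is linearly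
independent. -/
theorem linearIndependent_of_span_eq_top_of_card_eq {R M ι κ : Type*} [CommRing R]
    [AddCommGroup M] [Module R M] [Fintype ι] [Fintype κ] {v : ι → M} {w : κ → M}
    (hcard : Fintype.card κ = Fintype.card ι)
    (hv : LinearIndependent R v) (hw : Submodule.span R (Set.range w) = ⊤) :
    LinearIndependent R w := by
  have hfin : Module.Finite R M := ⟨⟨(Set.finite_range w).toFinset, by simpa using hw⟩⟩
  let e := Fintype.equivOfCardEq hcard
  have hv' : LinearIndependent R (v ∘ e) := hv.comp e e.injective
  -- Orzech: a surjection onto a finite module `M` from a module that embeds in `M` is injective.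
  -- The independent family provides the embedding.
  refine OrzechProperty.injective_of_surjective_of_injective
    (Finsupp.linearCombination R (v ∘ e)) (Finsupp.linearCombination R w) hv' ?_
  rw [← LinearMap.range_eq_top, Finsupp.range_linearCombination, hw]

/-! ### Adjoining one variable: a basis modulo the radical of the recursive form -/

section Adjoin

open Polynomial

variable {R ι : Type*} [CommRing R] {z : R} {τ' τ₀ : R →ₗ[ℤ] ℤ}

/-- The linear form on `R[X]` obtained from forms `τ'` and `τ₀` on `R`: its value at `X ^ i * f` is
`-τ' (z ^ i * f)`, corrected by `c * τ₀ (z ^ (i - (k + 1)) * f)` if `i > k`. -/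
noncomputable def adjoinForm (z : R) (τ' τ₀ : R →ₗ[ℤ] ℤ) (k : ℕ) (c : ℤ) : R[X] →ₗ[ℤ] ℤ :=
  Polynomial.lsum fun i => -(τ' ∘ₗ LinearMap.mulLeft ℤ (z ^ i)) +
    if k + 1 ≤ i then c • (τ₀ ∘ₗ LinearMap.mulLeft ℤ (z ^ (i - (k + 1)))) else 0

theorem adjoinForm_X_pow_mul_C (k : ℕ) (c : ℤ) (i : ℕ) (f : R) :
    adjoinForm z τ' τ₀ k c (X ^ i * C f) =
      -τ' (z ^ i * f) + if k + 1 ≤ i then c * τ₀ (z ^ (i - (k + 1)) * f) else 0 := by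
  rw [mul_comm, C_mul_X_pow_eq_monomial]
  simp only [adjoinForm, lsum_apply]
  rw [sum_monomial_index _ _ (by simp)]
  split_ifs <;> simp

variable {k : ℕ} {c : ℤ}

/-- In degrees at most k the form factors through the substitution X ↦ z. -/
theorem adjoinForm_pow_sub_pow_mul_C {i : ℕ} (hi : i ≤ k) (f : R) :
    adjoinForm z τ' τ₀ k c ((X ^ i - C (z ^ i)) * C f) = 0 := by
  have h := adjoinForm_X_pow_mul_C (z := z) (τ' := τ') (τ₀ := τ₀) k c 0 (z ^ i * f)
  rw [pow_zero, one_mul] at h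
  rw [sub_mul, map_sub, adjoinForm_X_pow_mul_C, ← C_mul, h]
  simp [show ¬ k + 1 ≤ i by omega]

/-- The two values of τ' are both taken at z^(i+j) f and cancel. Since j ≤ k, only X^(i+j) can carry
a correction, so this pairing sees τ₀ alone. -/
theorem adjoinForm_pow_sub_pow_mul_X_pow {i j : ℕ} (hj : j ≤ k) (f : R) :
    adjoinForm z τ' τ₀ k c ((X ^ i - C (z ^ i)) * C f * X ^ j) =
      if k + 1 ≤ i + j then c * τ₀ (z ^ (i + j - (k + 1)) * f) else 0 := by
  have : (X ^ i - C (z ^ i)) * C f * X ^ j = X ^ (i + j) * C f - X ^ j * C (z ^ i * f) := by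
    rw [C_mul]; ring
  rw [this, map_sub, adjoinForm_X_pow_mul_C, adjoinForm_X_pow_mul_C,
    if_neg (show ¬ k + 1 ≤ j by omega), ← mul_assoc, ← pow_add, add_comm j i]
  ring

/-- Division by the monic p reduces the test polynomial to degree at most k, where the form is -τ'
after X ↦ z. -/
theorem C_mem_formRadical_adjoinForm (hp : ∃ p : R[X], p.Monic ∧ p.natDegree = k + 1 ∧
    p ∈ formRadical (adjoinForm z τ' τ₀ k c)) {f : R} (hf : f ∈ formRadical τ') :
    C f ∈ formRadical (adjoinForm z τ' τ₀ k c) := by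
  obtain ⟨p, hpm, hpd, hpr⟩ := hp
  intro g
  rw [← modByMonic_add_div g p, mul_add, map_add]
  have h2 : adjoinForm z τ' τ₀ k c (C f * (p * (g /ₘ p))) = 0 := by
    rw [mul_left_comm]; exact hpr _
  have hdeg : (g %ₘ p).natDegree < k + 1 := by
    rw [← hpd]; exact natDegree_modByMonic_lt g hpm (by rintro rfl; simp at hpd)
  rw [h2, add_zero, (g %ₘ p).as_sum_range_C_mul_X_pow' hdeg, Finset.mul_sum, map_sum]
  refine Finset.sum_eq_zero fun i hi => ?_
  rw [Finset.mem_range] at hi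
  rw [show C f * (C ((g %ₘ p).coeff i) * X ^ i) = X ^ i * C (f * (g %ₘ p).coeff i) by
    rw [C_mul]; ring, adjoinForm_X_pow_mul_C, if_neg (by omega), add_zero, mul_left_comm, hf,
    neg_zero]

/-- After the same reduction modulo p, `adjoinForm_pow_sub_pow_mul_X_pow` expresses every pairing by
τ₀. -/
theorem pow_sub_pow_mul_C_mem_formRadical_adjoinForm (hp : ∃ p : R[X], p.Monic ∧
    p.natDegree = k + 1 ∧ p ∈ formRadical (adjoinForm z τ' τ₀ k c)) (i : ℕ) {f : R}
    (hf : f ∈ formRadical τ₀) :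
    (X ^ i - C (z ^ i)) * C f ∈ formRadical (adjoinForm z τ' τ₀ k c) := by
  obtain ⟨p, hpm, hpd, hpr⟩ := hp
  intro g
  rw [← modByMonic_add_div g p, mul_add, map_add]
  have h2 : adjoinForm z τ' τ₀ k c ((X ^ i - C (z ^ i)) * C f * (p * (g /ₘ p))) = 0 := by
    rw [mul_left_comm]; exact hpr _
  have hdeg : (g %ₘ p).natDegree < k + 1 := by
    rw [← hpd]; exact natDegree_modByMonic_lt g hpm (by rintro rfl; simp at hpd)
  rw [h2, add_zero, (g %ₘ p).as_sum_range_C_mul_X_pow' hdeg, Finset.mul_sum, map_sum]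
  refine Finset.sum_eq_zero fun j hj => ?_
  rw [Finset.mem_range] at hj
  rw [← mul_assoc, mul_assoc _ (C f), ← C_mul, adjoinForm_pow_sub_pow_mul_X_pow (by omega)]
  split_ifs
  · rw [mul_left_comm, hf, mul_zero]
  · rfl

/-- The pairing is block triangular. Constants detect the first block through τ'; on the second
block, powers of X give an antitriangular matrix with c τ₀ on the antidiagonal. -/
theorem linearIndependent_adjoinForm [Fintype ι] (hc : c ≠ 0) {Y : ι → R}
    (h₀ : IsBasisModRadical τ₀ Y)
    (h' : IsBasisModRadical τ' fun t : Fin (k + 2) × ι => z ^ (t.1 : ℕ) * Y t.2) :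
    LinearIndependent ℤ fun t : (Fin (k + 2) × ι) ⊕ (Fin k × ι) =>
      Ideal.Quotient.mk (formRadical (adjoinForm z τ' τ₀ k c)) (Sum.elim
        (fun t => C (z ^ (t.1 : ℕ) * Y t.2))
        (fun t => (X ^ (t.1 + 1 : ℕ) - C (z ^ (t.1 + 1 : ℕ))) * C (Y t.2)) t) := by
  rw [Fintype.linearIndependent_iff]
  intro a ha
  set f' : R := ∑ t : Fin (k + 2) × ι, a (Sum.inl t) • (z ^ (t.1 : ℕ) * Y t.2) with hf'
  set f : Fin k → R := fun i => ∑ T, a (Sum.inr (i, T)) • Y T with hf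
  have hmem : C f' + ∑ i : Fin k, (X ^ (i + 1 : ℕ) - C (z ^ (i + 1 : ℕ))) * C (f i) ∈
      formRadical (adjoinForm z τ' τ₀ k c) := by
    rw [← Ideal.Quotient.eq_zero_iff_mem, ← ha, Fintype.sum_sum_type, map_add]
    congr 1
    · rw [hf', map_sum, map_sum]
      exact Finset.sum_congr rfl fun t _ => by simp
    · rw [Fintype.sum_prod_type, map_sum]
      refine Finset.sum_congr rfl fun i _ => ?_
      simp only [hf, map_sum, Finset.mul_sum]
      exact Finset.sum_congr rfl fun t _ => by simp; ring
  clear_value f'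
  -- Pairing with constants kills all the terms (X^i - z^i) f_i, because i ≤ k.
  have hf'0 : f' ∈ formRadical τ' := by
    intro g
    have h := hmem (C g)
    rw [add_mul, map_add, Finset.sum_mul, map_sum, Finset.sum_eq_zero (s := Finset.univ),
      add_zero] at h
    · have h2 := adjoinForm_X_pow_mul_C (z := z) (τ' := τ') (τ₀ := τ₀) k c 0 (f' * g)
      rw [pow_zero, one_mul, C_mul, h] at h2
      simpa using h2.symm
    · intro i _
      rw [mul_assoc, ← C_mul]
      exact adjoinForm_pow_sub_pow_mul_C (by omega) _
  have ha' := fun t => h'.eq_zero_of_sum_mem (hf' ▸ hf'0) t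
  have hf'z : f' = 0 := hf'.trans <| Finset.sum_eq_zero fun t _ => by rw [ha' t, zero_smul]
  rw [hf'z, C_0, zero_add] at hmem
  -- Descending induction on the index: m = k - 1 - i, starting at i = k - 1.
  have hfj : ∀ m : ℕ, ∀ i : Fin k, k - 1 - (i : ℕ) = m → f i ∈ formRadical τ₀ := by
    intro m
    induction m using Nat.strong_induction_on with
    | _ m ih =>
    intro i hi g
    -- The exponent is chosen so that (i + 1) + (m + 1) = k + 1. Smaller indices do not reach k + 1
    -- and contribute 0; larger ones vanish by induction.
    have h := hmem (X ^ (m + 1) * C g)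
    rw [Finset.sum_mul, map_sum, Finset.sum_eq_single i] at h
    · rw [show (X ^ (i + 1 : ℕ) - C (z ^ (i + 1 : ℕ))) * C (f i) * (X ^ (m + 1) * C g) =
        (X ^ (i + 1 : ℕ) - C (z ^ (i + 1 : ℕ))) * C (f i * g) * X ^ (m + 1) by
        rw [C_mul]; ring, adjoinForm_pow_sub_pow_mul_X_pow (by omega), if_pos (by omega),
        show (i + 1 + (m + 1) - (k + 1) : ℕ) = 0 by omega, pow_zero, one_mul] at h
      exact (mul_eq_zero.1 h).resolve_left hc
    · intro j _ hji
      rw [show (X ^ (j + 1 : ℕ) - C (z ^ (j + 1 : ℕ))) * C (f j) * (X ^ (m + 1) * C g) =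
        (X ^ (j + 1 : ℕ) - C (z ^ (j + 1 : ℕ))) * C (f j * g) * X ^ (m + 1) by
        rw [C_mul]; ring, adjoinForm_pow_sub_pow_mul_X_pow (by omega)]
      split_ifs with hle
      · have hlt : (i : ℕ) < j := by
          have := Fin.val_ne_of_ne hji
          omega
        rw [mul_left_comm, ih (k - 1 - j) (by omega) j rfl, mul_zero]
      · rfl
    · simp
  rintro (t | ⟨i, T⟩)
  · exact ha' t
  · exact h₀.eq_zero_of_sum_mem (c := fun T => a (Sum.inr (i, T))) (hfj _ i rfl) T

/-- The monic p bounds the X-degree by k. The coefficients of the powers of X are then expanded in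
the two given bases, the errors lying in the radical by the two preceding membership lemmas. -/
theorem span_adjoinForm [Fintype ι] {Y : ι → R} (hp : ∃ p : R[X], p.Monic ∧
    p.natDegree = k + 1 ∧ p ∈ formRadical (adjoinForm z τ' τ₀ k c))
    (h₀ : IsBasisModRadical τ₀ Y)
    (h' : IsBasisModRadical τ' fun t : Fin (k + 2) × ι => z ^ (t.1 : ℕ) * Y t.2) :
    Submodule.span ℤ (Set.range fun t : Fin (k + 1) × Fin 2 × ι =>
      Ideal.Quotient.mk (formRadical (adjoinForm z τ' τ₀ k c))
        (X ^ (t.1 : ℕ) * C (z ^ (t.2.1 : ℕ) * Y t.2.2))) = ⊤ := by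
  set M := Submodule.span ℤ (Set.range fun t : Fin (k + 1) × Fin 2 × ι =>
      Ideal.Quotient.mk (formRadical (adjoinForm z τ' τ₀ k c))
        (X ^ (t.1 : ℕ) * C (z ^ (t.2.1 : ℕ) * Y t.2.2))) with hM
  set q := Ideal.Quotient.mk (formRadical (adjoinForm z τ' τ₀ k c)) with hq
  have hgen : ∀ i ≤ k, ∀ T, q (X ^ i * C (Y T)) ∈ M := fun i hi T =>
    Submodule.subset_span ⟨(⟨i, by omega⟩, 0, T), by simp [hq]⟩
  have hgen' : ∀ i ≤ k, ∀ T, q (X ^ i * C (z * Y T)) ∈ M := fun i hi T =>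
    Submodule.subset_span ⟨(⟨i, by omega⟩, 1, T), by simp [hq]⟩
  -- Multiples of X^i - z^i depend on f only modulo the radical of τ₀, so f may be expanded in the
  -- Y_T.
  have hdiff : ∀ i ≤ k, (∀ T, q (C (z ^ i * Y T)) ∈ M) →
      ∀ f, q ((X ^ i - C (z ^ i)) * C f) ∈ M := by
    intro i hi h f
    obtain ⟨a, ha⟩ := h₀.exists_sub_mem f
    have h1 := pow_sub_pow_mul_C_mem_formRadical_adjoinForm hp i ha
    rw [C_sub, mul_sub, ← Ideal.Quotient.eq, ← hq] at h1
    rw [h1, map_sum, Finset.mul_sum, map_sum]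
    refine Submodule.sum_mem _ fun T _ => ?_
    have : q ((X ^ i - C (z ^ i)) * C (a T • Y T)) =
        a T • (q (X ^ i * C (Y T)) - q (C (z ^ i * Y T))) := by
      simp only [zsmul_eq_mul, map_mul, map_sub, map_pow, map_intCast]
      ring
    rw [this]
    exact Submodule.smul_mem _ _ (Submodule.sub_mem _ (hgen i hi T) (h T))
  -- Powers of z are traded for powers of X one at a time: z^(i+1) Y = X^i z Y - (X^i - z^i) z Y,
  -- where `hdiff` handles the last term.
  have hC : ∀ i ≤ k + 1, ∀ T, q (C (z ^ i * Y T)) ∈ M := by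
    intro i
    induction i with
    | zero => intro _ T; simpa using hgen 0 (by omega) T
    | succ i ih =>
      intro hi T
      have h1 := hdiff i (by omega) (ih (by omega)) (z * Y T)
      have h2 := hgen' i (by omega) T
      have : q (C (z ^ (i + 1) * Y T)) =
          q (X ^ i * C (z * Y T)) - q ((X ^ i - C (z ^ i)) * C (z * Y T)) := by
        simp only [map_mul, map_sub, map_pow]
        ring
      rw [this]
      exact Submodule.sub_mem _ h2 h1
  have hCf : ∀ f, q (C f) ∈ M := by
    intro f
    obtain ⟨a, ha⟩ := h'.exists_sub_mem f
    have h1 := C_mem_formRadical_adjoinForm hp ha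
    rw [C_sub, ← Ideal.Quotient.eq, ← hq] at h1
    rw [h1, map_sum, map_sum]
    refine Submodule.sum_mem _ fun t _ => ?_
    have : q (C (a t • (z ^ (t.1 : ℕ) * Y t.2))) = a t • q (C (z ^ (t.1 : ℕ) * Y t.2)) := by
      simp only [zsmul_eq_mul, map_mul, map_intCast]
    rw [this]
    exact Submodule.smul_mem _ _ (hC _ (by omega) _)
  have hX : ∀ i ≤ k, ∀ f, q (X ^ i * C f) ∈ M := by
    intro i hi f
    have : q (X ^ i * C f) = q ((X ^ i - C (z ^ i)) * C f) + q (C (z ^ i * f)) := by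
      simp only [map_mul, map_sub, map_pow]
      ring
    rw [this]
    exact Submodule.add_mem _ (hdiff i hi (hC i (by omega)) f) (hCf _)
  rw [eq_top_iff]
  rintro x -
  obtain ⟨g, rfl⟩ := Ideal.Quotient.mk_surjective x
  obtain ⟨p, hpm, hpd, hpr⟩ := hp
  have hg : q g = q (g %ₘ p) := by
    rw [hq, Ideal.Quotient.eq]
    have : g - g %ₘ p = (g /ₘ p) * p := by
      conv_lhs => rw [← modByMonic_add_div g p]
      rw [modByMonic_add_div]
      linear_combination - modByMonic_add_div g p
    rw [this]
    exact Ideal.mul_mem_left _ _ hpr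
  have hdeg : (g %ₘ p).natDegree < k + 1 := by
    rw [← hpd]; exact natDegree_modByMonic_lt g hpm (by rintro rfl; simp at hpd)
  rw [hg, (g %ₘ p).as_sum_range_C_mul_X_pow' hdeg, map_sum]
  refine Submodule.sum_mem _ fun i hi => ?_
  rw [mul_comm]
  exact hX i (by rw [Finset.mem_range] at hi; omega) _

theorem isBasisModRadical_adjoinForm [Fintype ι] (hc : c ≠ 0) {Y : ι → R}
    (hp : ∃ p : R[X], p.Monic ∧ p.natDegree = k + 1 ∧ p ∈ formRadical (adjoinForm z τ' τ₀ k c))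
    (h₀ : IsBasisModRadical τ₀ Y)
    (h' : IsBasisModRadical τ' fun t : Fin (k + 2) × ι => z ^ (t.1 : ℕ) * Y t.2) :
    IsBasisModRadical (adjoinForm z τ' τ₀ k c) fun t : Fin (k + 1) × Fin 2 × ι =>
        (X ^ (t.1 : ℕ) * C (z ^ (t.2.1 : ℕ) * Y t.2.2)) where
  linearIndependent := linearIndependent_of_span_eq_top_of_card_eq
    -- The count is 2(k + 1) = (k + 2) + k.
    (by simp only [Fintype.card_prod, Fintype.card_sum, Fintype.card_fin]; ring)
    (linearIndependent_adjoinForm hc h₀ h') (span_adjoinForm hp h₀ h')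
  span_eq_top := span_adjoinForm hp h₀ h'

end Adjoin

/-! ### Sums over sequences of distinct variables -/

noncomputable section

open MvPolynomial

/-- `q` is a polynomial with constant coefficient `a`. -/
def HasConstant {σ : Type} (q : FractionRing (MvPolynomial σ ℤ)) (a : ℤ) : Prop :=
  ∃ p : MvPolynomial σ ℤ, algebraMap _ (FractionRing (MvPolynomial σ ℤ)) p = q ∧
    constantCoeff p = a

namespace HasConstant

variable {σ : Type} {q r : FractionRing (MvPolynomial σ ℤ)} {a b : ℤ}

theorem of_poly (p : MvPolynomial σ ℤ) :
    HasConstant (algebraMap _ (FractionRing (MvPolynomial σ ℤ)) p) (constantCoeff p) :=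
  ⟨p, rfl, rfl⟩

theorem add (hq : HasConstant q a) (hr : HasConstant r b) : HasConstant (q + r) (a + b) := by
  obtain ⟨p, rfl, rfl⟩ := hq
  obtain ⟨s, rfl, rfl⟩ := hr
  exact ⟨p + s, map_add _ _ _, map_add _ _ _⟩

theorem neg (hq : HasConstant q a) : HasConstant (-q) (-a) := by
  obtain ⟨p, rfl, rfl⟩ := hq
  exact ⟨-p, map_neg _ _, map_neg _ _⟩

theorem mul (hq : HasConstant q a) (hr : HasConstant r b) : HasConstant (q * r) (a * b) := by
  obtain ⟨p, rfl, rfl⟩ := hq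
  obtain ⟨s, rfl, rfl⟩ := hr
  exact ⟨p * s, map_mul _ _ _, map_mul _ _ _⟩

theorem zero : HasConstant (0 : FractionRing (MvPolynomial σ ℤ)) 0 :=
  ⟨0, map_zero _, map_zero _⟩

theorem one : HasConstant (1 : FractionRing (MvPolynomial σ ℤ)) 1 :=
  ⟨1, map_one _, map_one _⟩

theorem sum {ι : Type*} {s : Finset ι} {q : ι → FractionRing (MvPolynomial σ ℤ)} {a : ι → ℤ}
    (h : ∀ i ∈ s, HasConstant (q i) (a i)) : HasConstant (∑ i ∈ s, q i) (∑ i ∈ s, a i) := by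
  classical
  induction s using Finset.induction_on with
  | empty => simpa using zero
  | insert i s hi ih =>
    rw [Finset.sum_insert hi, Finset.sum_insert hi]
    exact (h i (by simp)).add (ih fun j hj => h j (by simp [hj]))

theorem unique (hq : HasConstant q a) (hq' : HasConstant q b) : a = b := by
  obtain ⟨p, hp, rfl⟩ := hq
  obtain ⟨s, hs, rfl⟩ := hq'
  rw [IsFractionRing.injective (MvPolynomial σ ℤ) (FractionRing (MvPolynomial σ ℤ))
    (hp.trans hs.symm)]

end HasConstant

/-- The variable `x_i` as a rational function. -/
def ratVar {σ : Type} (i : σ) : FractionRing (MvPolynomial σ ℤ) :=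
  algebraMap (MvPolynomial σ ℤ) _ (X i)

theorem ratVar_injective {σ : Type} : Function.Injective (ratVar (σ := σ)) :=
  (IsFractionRing.injective (MvPolynomial σ ℤ) (FractionRing (MvPolynomial σ ℤ))).comp
    X_injective

theorem ratVar_sub_ne_zero {σ : Type} {i j : σ} (h : i ≠ j) : ratVar i - ratVar j ≠ 0 :=
  sub_ne_zero.2 (ratVar_injective.ne h)

theorem hasConstant_ratVar {σ : Type} (i : σ) : HasConstant (ratVar i) 0 :=
  ⟨X i, rfl, constantCoeff_X _ _⟩

/-! ### Complete symmetric polynomials as sums of fractions -/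

section Complete

variable {σ : Type} [DecidableEq σ]

/-- `∑_{b ∈ S} x_b ^ i / ∏_{a ≠ b} (x_b - x_a)`, a complete symmetric polynomial. -/
def completeSum (S : Finset σ) (i : ℕ) : FractionRing (MvPolynomial σ ℤ) :=
  ∑ b ∈ S, ratVar b ^ i / ∏ a ∈ S.erase b, (ratVar b - ratVar a)

/-- Subtracting x_c times the sum puts x_b - x_c into each numerator: this removes the term b = c
and cancels the factor of c in the others. -/
theorem completeSum_insert_succ {S : Finset σ} {c : σ} (hc : c ∉ S) (i : ℕ) :
    completeSum (insert c S) (i + 1) =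
      ratVar c * completeSum (insert c S) i + completeSum S i := by
  have h : completeSum (insert c S) (i + 1) - ratVar c * completeSum (insert c S) i =
      completeSum S i := by
    simp only [completeSum, Finset.mul_sum]
    rw [← Finset.sum_sub_distrib, Finset.sum_insert hc, pow_succ']
    rw [mul_div_assoc, sub_self, zero_add]
    refine Finset.sum_congr rfl fun b hb => ?_
    have hbc : b ≠ c := fun h => hc (h ▸ hb)
    rw [Finset.erase_insert_of_ne hbc.symm, Finset.prod_insert (by simp [hc])]
    have h1 := ratVar_sub_ne_zero hbc
    have h2 : ∏ a ∈ S.erase b, (ratVar b - ratVar a) ≠ 0 :=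
      Finset.prod_ne_zero_iff.2 fun a ha => ratVar_sub_ne_zero (Finset.ne_of_mem_erase ha).symm
    field_simp
    ring
  rw [← h]; ring

theorem completeSum_singleton (c : σ) (i : ℕ) : completeSum {c} i = ratVar c ^ i := by
  simp [completeSum]

/-- Removing either of two elements c, d by the recursion leaves equal sums (both 1 or, by
induction, both 0), so (x_c - x_d) times the sum is 0. -/
theorem completeSum_zero {S : Finset σ} (hS : 2 ≤ S.card) : completeSum S 0 = 0 := by
  induction hn : S.card using Nat.strong_induction_on generalizing S with
  | _ n ih =>
  obtain ⟨c, hc, d, hd, hcd⟩ := Finset.one_lt_card.1 hS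
  have h1 := completeSum_insert_succ (Finset.notMem_erase c S) 0
  have h2 := completeSum_insert_succ (Finset.notMem_erase d S) 0
  rw [Finset.insert_erase hc] at h1
  rw [Finset.insert_erase hd] at h2
  have h3 : completeSum (S.erase c) 0 = completeSum (S.erase d) 0 := by
    have hcc := Finset.card_erase_of_mem hc
    have hdc := Finset.card_erase_of_mem hd
    by_cases h : S.card = 2
    · obtain ⟨e, he⟩ := Finset.card_eq_one.1 (show (S.erase c).card = 1 by omega)
      obtain ⟨f, hf⟩ := Finset.card_eq_one.1 (show (S.erase d).card = 1 by omega)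
      rw [he, hf, completeSum_singleton, completeSum_singleton, pow_zero, pow_zero]
    · rw [ih _ (by omega) (by omega) rfl, ih _ (by omega) (by omega) rfl]
  have h4 : (ratVar c - ratVar d) * completeSum S 0 = 0 := by
    linear_combination h2 - h1 - h3
  exact (mul_eq_zero.1 h4).resolve_left (ratVar_sub_ne_zero hcd)

/-- The sum is the complete symmetric polynomial of degree i + 1 - |S|, which has a constant term
only in degree 0. -/
theorem hasConstant_completeSum {S : Finset σ} (hS : S.Nonempty) (i : ℕ) :
    HasConstant (completeSum S i) (if i + 1 = S.card then 1 else 0) := by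
  induction hS using Finset.Nonempty.cons_induction generalizing i with
  | singleton c =>
    rw [completeSum_singleton]
    cases i with
    | zero => simpa using HasConstant.one
    | succ i => simpa [pow_succ'] using ⟨X c * X c ^ i, by simp [ratVar], by simp⟩
  | cons c S hc hS ih =>
    rw [Finset.cons_eq_insert]
    have hcard := Finset.card_insert_of_notMem hc
    have := hS.card_pos
    induction i with
    | zero =>
      rw [completeSum_zero (by omega), if_neg (by omega)]
      exact HasConstant.zero
    | succ i ihi =>
      rw [completeSum_insert_succ hc]
      convert ((hasConstant_ratVar c).mul ihi).add (ih i) using 1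
      simp [hcard]

end Complete

/-! ### The recursion for sums over sequences -/

section Sequences

variable {σ : Type} [Fintype σ] [DecidableEq σ]

/-- The sequences of `ℓ + 1` distinct elements of `S`. -/
def injSeq (ℓ : ℕ) (S : Finset σ) : Finset (Fin (ℓ + 1) → σ) :=
  by classical exact {b | Function.Injective b ∧ ∀ j, b j ∈ S}

theorem mem_injSeq {ℓ : ℕ} {S : Finset σ} {b : Fin (ℓ + 1) → σ} :
    b ∈ injSeq ℓ S ↔ Function.Injective b ∧ ∀ j, b j ∈ S := by
  simp [injSeq]

theorem sum_injSeq_succ {M : Type*} [AddCommMonoid M] {ℓ : ℕ} (S : Finset σ)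
    (g : (Fin (ℓ + 2) → σ) → M) :
    ∑ b ∈ injSeq (ℓ + 1) S, g b =
      ∑ b ∈ injSeq ℓ S, ∑ c ∈ S \ Finset.univ.image b, g (Fin.cons c b) := by
  rw [Finset.sum_sigma']
  refine Finset.sum_bij' (fun b _ => ⟨Fin.tail b, b 0⟩) (fun b _ => Fin.cons b.2 b.1) ?_ ?_ ?_ ?_ ?_
  · intro b hb
    rw [mem_injSeq] at hb
    simp only [Finset.mem_sigma, mem_injSeq, Finset.mem_sdiff, Finset.mem_image, Finset.mem_univ,
      true_and, not_exists]
    exact ⟨⟨hb.1.comp (Fin.succ_injective _), fun j => hb.2 _⟩, hb.2 _,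
      fun j hj => Fin.succ_ne_zero j (hb.1 hj)⟩
  · rintro ⟨b, c⟩ hb
    simp only [Finset.mem_sigma, mem_injSeq, Finset.mem_sdiff, Finset.mem_image, Finset.mem_univ,
      true_and, not_exists] at hb
    rw [mem_injSeq, Fin.cons_injective_iff]
    refine ⟨⟨?_, hb.1.1⟩, Fin.cases hb.2.1 hb.1.2⟩
    rintro ⟨j, hj⟩
    exact hb.2.2 j hj
  · intro b _; simp
  · rintro ⟨b, c⟩ _; simp
  · intro b _; simp

/-- Sequences are sorted by the set A that they omit; by cardinality, those omitting A are exactly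
the enumerations of S \ A. -/
theorem sum_injSeq_fiberwise {M : Type*} [AddCommMonoid M] {ℓ m : ℕ} {S : Finset σ}
    (hS : S.card = m + (ℓ + 1)) (g : Finset σ → (Fin (ℓ + 1) → σ) → M) :
    ∑ b ∈ injSeq ℓ S, g (S \ Finset.univ.image b) b =
      ∑ A ∈ S.powersetCard m, ∑ b ∈ injSeq ℓ (S \ A), g A b := by
  have himage : ∀ b ∈ injSeq ℓ S, Finset.univ.image b ⊆ S ∧
      (Finset.univ.image b).card = ℓ + 1 := by
    intro b hb
    rw [mem_injSeq] at hb
    refine ⟨?_, by rw [Finset.card_image_of_injective _ hb.1, Finset.card_fin]⟩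
    intro i hi
    obtain ⟨j, -, rfl⟩ := Finset.mem_image.1 hi
    exact hb.2 j
  rw [← Finset.sum_fiberwise_of_maps_to (t := S.powersetCard m)
    (g := fun b => S \ Finset.univ.image b)]
  · refine Finset.sum_congr rfl fun A hA => ?_
    rw [Finset.mem_powersetCard] at hA
    have : {b ∈ injSeq ℓ S | S \ Finset.univ.image b = A} = injSeq ℓ (S \ A) := by
      ext b
      rw [Finset.mem_filter]
      constructor
      · rintro ⟨hb, rfl⟩
        have h := himage b hb
        rw [mem_injSeq] at hb ⊢
        refine ⟨hb.1, fun j => ?_⟩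
        rw [Finset.sdiff_sdiff_eq_self h.1]
        exact Finset.mem_image_of_mem _ (Finset.mem_univ _)
      · intro hb
        have hb' := hb
        rw [mem_injSeq] at hb'
        have hbS : b ∈ injSeq ℓ S :=
          mem_injSeq.2 ⟨hb'.1, fun j => (Finset.mem_sdiff.1 (hb'.2 j)).1⟩
        refine ⟨hbS, ?_⟩
        have h1 : Finset.univ.image b ⊆ S \ A := by
          intro i hi
          obtain ⟨j, -, rfl⟩ := Finset.mem_image.1 hi
          exact hb'.2 j
        have h2 : Finset.univ.image b = S \ A := by
          refine Finset.eq_of_subset_of_card_le h1 ?_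
          rw [(himage b hbS).2, Finset.card_sdiff_of_subset hA.1]
          omega
        rw [h2, Finset.sdiff_sdiff_eq_self hA.1]
    rw [← this]
    refine Finset.sum_congr rfl fun b hb => ?_
    rw [(Finset.mem_filter.1 hb).2]
  · intro b hb
    have h := himage b hb
    rw [Finset.mem_powersetCard]
    refine ⟨Finset.sdiff_subset, ?_⟩
    rw [Finset.card_sdiff_of_subset h.1, h.2]
    omega

/-- `∏_j (x_{b_j} - x_{b_{j+1}})`. -/
def seqDenominator {σ : Type} {ℓ : ℕ} (b : Fin (ℓ + 1) → σ) : FractionRing (MvPolynomial σ ℤ) :=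
  ∏ j : Fin ℓ, (ratVar (b j.castSucc) - ratVar (b j.succ))

theorem seqDenominator_cons {σ : Type} {ℓ : ℕ} (c : σ) (b : Fin (ℓ + 1) → σ) :
    seqDenominator (Fin.cons c b : Fin (ℓ + 2) → σ) =
      (ratVar c - ratVar (b 0)) * seqDenominator b := by
  rw [seqDenominator, Fin.prod_univ_succ]
  simp [seqDenominator]

theorem finSuccEquiv_rename_succ {R : Type*} [CommRing R] {n : ℕ} (f : MvPolynomial (Fin n) R) :
    finSuccEquiv R n (rename Fin.succ f) = Polynomial.C f := by
  induction f using MvPolynomial.induction_on with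
  | C a => rw [rename_C]; exact (finSuccEquiv R n).commutes a
  | add p q hp hq => simp [hp, hq]
  | mul_X p j hp => simp [hp, finSuccEquiv_X_succ]

/-- `f(x_{b_0}, …, x_{b_ℓ})` as a rational function. -/
def seqNumerator {σ : Type} {ℓ : ℕ} (f : MvPolynomial (Fin (ℓ + 1)) ℤ) (b : Fin (ℓ + 1) → σ) :
    FractionRing (MvPolynomial σ ℤ) :=
  algebraMap (MvPolynomial σ ℤ) _ (rename b f)

/-- The sum over all sequences `b` of `ℓ + 1` distinct elements of `S` of the value of `f` at
`x_{b_0}, …, x_{b_ℓ}` divided by `∏_{a ∈ S \ b} (x_{b_0} - x_a) ∏_j (x_{b_j} - x_{b_{j+1}})`. -/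
def chainSum (ℓ : ℕ) (S : Finset σ) (f : MvPolynomial (Fin (ℓ + 1)) ℤ) :
    FractionRing (MvPolynomial σ ℤ) :=
  ∑ b ∈ injSeq ℓ S, seqNumerator f b /
    ((∏ a ∈ S \ Finset.univ.image b, (ratVar (b 0) - ratVar a)) * seqDenominator b)

theorem chainSum_add (ℓ : ℕ) (S : Finset σ) (f g : MvPolynomial (Fin (ℓ + 1)) ℤ) :
    chainSum ℓ S (f + g) = chainSum ℓ S f + chainSum ℓ S g := by
  simp only [chainSum, seqNumerator, map_add, add_div, Finset.sum_add_distrib]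

/-- The sum over sequences which arises when the first term of a longer sequence is summed. -/
def splitSum (ℓ : ℕ) (S : Finset σ) (i : ℕ) (f : MvPolynomial (Fin (ℓ + 1)) ℤ) :
    FractionRing (MvPolynomial σ ℤ) :=
  ∑ b ∈ injSeq ℓ S, seqNumerator f b / seqDenominator b *
    completeSum (insert (b 0) (S \ Finset.univ.image b)) i

/-- The sum over the first color c of the longer sequence is a complete sum over the unused colors
together with b_0, except that its term for b_0 is missing. That term is what -`chainSum`
compensates. -/
theorem chainSum_succ {ℓ : ℕ} (S : Finset σ) (i : ℕ) (f : MvPolynomial (Fin (ℓ + 1)) ℤ) :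
    chainSum (ℓ + 1) S ((finSuccEquiv ℤ (ℓ + 1)).symm (Polynomial.X ^ i * Polynomial.C f)) =
      -chainSum ℓ S (X 0 ^ i * f) + splitSum ℓ S i f := by
  have hsymm : (finSuccEquiv ℤ (ℓ + 1)).symm (Polynomial.X ^ i * Polynomial.C f) =
      X 0 ^ i * rename Fin.succ f := by
    rw [AlgEquiv.symm_apply_eq, map_mul, map_pow, finSuccEquiv_X_zero, finSuccEquiv_rename_succ]
  rw [hsymm, chainSum, sum_injSeq_succ, chainSum, splitSum, ← Finset.sum_neg_distrib,
    ← Finset.sum_add_distrib]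
  refine Finset.sum_congr rfl fun b hb => ?_
  set A := S \ Finset.univ.image b with hA
  have hbA : b 0 ∉ A := by simp [hA]
  rw [completeSum, Finset.sum_insert hbA, Finset.erase_insert hbA, mul_add, ← add_assoc]
  have h1 : -(seqNumerator (X 0 ^ i * f) b /
      ((∏ a ∈ A, (ratVar (b 0) - ratVar a)) * seqDenominator b)) +
      seqNumerator f b / seqDenominator b *
        (ratVar (b 0) ^ i / ∏ a ∈ A, (ratVar (b 0) - ratVar a)) = 0 := by
    have : seqNumerator (X 0 ^ i * f) b = ratVar (b 0) ^ i * seqNumerator f b := by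
      simp [seqNumerator, ratVar]
    rw [this, div_mul_div_comm, mul_comm (ratVar _ ^ i), mul_comm (∏ a ∈ A, _)]
    ring
  rw [h1, zero_add, Finset.mul_sum]
  refine Finset.sum_congr rfl fun c hc => ?_
  have hcb : b 0 ≠ c := fun h => hbA (h ▸ hc)
  have h2 : S \ Finset.univ.image (Fin.cons c b : Fin (ℓ + 2) → σ) = A.erase c := by
    ext a
    simp only [hA, Finset.mem_sdiff, Finset.mem_image, Finset.mem_univ, true_and, Fin.exists_fin_succ,
      Fin.cons_zero, Fin.cons_succ, Finset.mem_erase]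
    constructor
    · rintro ⟨h, h'⟩
      push Not at h'
      exact ⟨h'.1.symm, h, by push Not; exact h'.2⟩
    · rintro ⟨h, h', h''⟩
      refine ⟨h', ?_⟩
      rintro (h3 | h3)
      · exact h h3.symm
      · exact h'' h3
  have h3 : seqNumerator (X 0 ^ i * rename Fin.succ f) (Fin.cons c b : Fin (ℓ + 2) → σ) =
      ratVar c ^ i * seqNumerator f b := by
    simp only [seqNumerator, ratVar, map_mul, map_pow, rename_X, Fin.cons_zero, rename_rename]
    rfl
  rw [h2, h3, seqDenominator_cons, Fin.cons_zero, Finset.erase_insert_of_ne hcb,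
    Finset.prod_insert (by simp [hbA])]
  rw [div_mul_div_comm]
  congr 1 <;> ring

theorem splitSum_zero {ℓ k : ℕ} {S : Finset σ} (hS : S.card = k + 1 + (ℓ + 1))
    (f : MvPolynomial (Fin (ℓ + 1)) ℤ) : splitSum ℓ S 0 f = 0 := by
  refine Finset.sum_eq_zero fun b hb => ?_
  rw [mem_injSeq] at hb
  rw [completeSum_zero, mul_zero]
  rw [Finset.card_insert_of_notMem (by simp)]
  have := Finset.le_card_sdiff (Finset.univ.image b) S
  rw [Finset.card_image_of_injective _ hb.1, Finset.card_fin] at this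
  omega

/-- Taking b_0 out of the complete sum leaves a factor that depends only on the omitted set A, so
the sequences can be grouped by A. -/
theorem splitSum_succ {ℓ k : ℕ} {S : Finset σ} (hS : S.card = k + 1 + (ℓ + 1)) (i : ℕ)
    (f : MvPolynomial (Fin (ℓ + 1)) ℤ) :
    splitSum ℓ S (i + 1) f = splitSum ℓ S i (X 0 * f) +
      ∑ A ∈ S.powersetCard (k + 1), completeSum A i * chainSum ℓ (S \ A) f := by
  have h1 : ∑ A ∈ S.powersetCard (k + 1), completeSum A i * chainSum ℓ (S \ A) f =
      ∑ b ∈ injSeq ℓ S, seqNumerator f b / seqDenominator b *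
        completeSum (S \ Finset.univ.image b) i := by
    rw [sum_injSeq_fiberwise hS fun A b => seqNumerator f b / seqDenominator b * completeSum A i]
    refine Finset.sum_congr rfl fun A hA => ?_
    rw [Finset.mem_powersetCard] at hA
    rw [chainSum, Finset.mul_sum]
    refine Finset.sum_congr rfl fun b hb => ?_
    rw [mem_injSeq] at hb
    -- A sequence in S \ A uses up all of S \ A, so the inner sums are those with no leftover
    -- colors.
    have h2 : (S \ A) \ Finset.univ.image b = ∅ := by
      rw [← Finset.card_eq_zero, Finset.card_sdiff_of_subset, Finset.card_sdiff_of_subset hA.1,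
        Finset.card_image_of_injective _ hb.1, Finset.card_fin]
      · omega
      · intro i hi
        obtain ⟨j, -, rfl⟩ := Finset.mem_image.1 hi
        exact hb.2 j
    rw [h2, Finset.prod_empty, one_mul, mul_comm]
  rw [h1, splitSum, splitSum, ← Finset.sum_add_distrib]
  refine Finset.sum_congr rfl fun b _ => ?_
  rw [completeSum_insert_succ (by simp)]
  have : seqNumerator (X 0 * f) b = ratVar (b 0) * seqNumerator f b := by
    simp [seqNumerator, ratVar]
  rw [this]
  ring

end Sequences

/-! ### Values at zero of the sums over sequences -/

/-- The linear form on `ℤ[y_0, …, y_ℓ]` which gives the value at `0` of `chainSum`. -/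
def chainForm : (ℓ : ℕ) → ℕ → MvPolynomial (Fin (ℓ + 1)) ℤ →ₗ[ℤ] ℤ
  | 0, k => lcoeff ℤ (Finsupp.single 0 k)
  | ℓ + 1, k => adjoinForm (X 0) (chainForm ℓ (k + 1)) (chainForm ℓ 0) k
      ((k + ℓ + 2).choose (k + 1)) ∘ₗ (finSuccEquiv ℤ (ℓ + 1)).toLinearMap

theorem chainForm_succ {ℓ k : ℕ} (f : Polynomial (MvPolynomial (Fin (ℓ + 1)) ℤ)) :
    chainForm (ℓ + 1) k ((finSuccEquiv ℤ (ℓ + 1)).symm f) =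
      adjoinForm (X 0) (chainForm ℓ (k + 1)) (chainForm ℓ 0) k ((k + ℓ + 2).choose (k + 1)) f := by
  simp [chainForm]

section Sequences

variable {σ : Type} [Fintype σ] [DecidableEq σ]

/-- Each step of the recursion in i multiplies f by y_0. The sum over A contributes at the constant
term only for i = k, where all complete sums have constant term 1; the binomial coefficient counts
the sets A. -/
theorem hasConstant_splitSum {ℓ k : ℕ} {S : Finset σ} (hS : S.card = k + 1 + (ℓ + 1))
    (h : ∀ A ⊆ S, A.card = ℓ + 1 → ∀ f, HasConstant (chainSum ℓ A f) (chainForm ℓ 0 f)) (i : ℕ)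
    (f : MvPolynomial (Fin (ℓ + 1)) ℤ) :
    HasConstant (splitSum ℓ S i f) (if k + 1 ≤ i then
      ((k + ℓ + 2).choose (k + 1) : ℕ) * chainForm ℓ 0 (X 0 ^ (i - (k + 1)) * f) else 0) := by
  induction i generalizing f with
  | zero =>
    rw [splitSum_zero hS]
    simpa using HasConstant.zero
  | succ i ih =>
    rw [splitSum_succ hS]
    have hsum : HasConstant (∑ A ∈ S.powersetCard (k + 1), completeSum A i * chainSum ℓ (S \ A) f)
        (∑ A ∈ S.powersetCard (k + 1), (if i = k then 1 else 0) * chainForm ℓ 0 f) := by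
      refine HasConstant.sum fun A hA => ?_
      rw [Finset.mem_powersetCard] at hA
      refine HasConstant.mul ?_ (h _ Finset.sdiff_subset ?_ f)
      · have := hasConstant_completeSum (Finset.card_pos.1 (by omega : 0 < A.card)) i
        rw [hA.2] at this
        simpa using this
      · rw [Finset.card_sdiff_of_subset hA.1]; omega
    convert (ih (X 0 * f)).add hsum using 1
    rw [Finset.sum_const, Finset.card_powersetCard, hS,
      show k + 1 + (ℓ + 1) = k + ℓ + 2 by omega]
    rcases lt_trichotomy i k with hik | rfl | hik
    · rw [if_neg (by omega), if_neg (by omega), if_neg (by omega)]; simp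
    · rw [if_pos (by omega), if_neg (by omega), if_pos rfl]; simp
    · rw [if_pos (by omega), if_pos (by omega), if_neg (by omega), ← mul_assoc, ← pow_succ,
        show i + 1 - (k + 1) = i - (k + 1) + 1 by omega]
      simp

/-- Induction on ℓ for all k and S at once: the recursion calls k + 1 on S itself and 0 on subsets
of S. For ℓ = 0 the sum is a complete sum over k + 1 variables. -/
theorem hasConstant_chainSum {ℓ k : ℕ} {S : Finset σ} (hS : S.card = k + (ℓ + 1))
    (f : MvPolynomial (Fin (ℓ + 1)) ℤ) : HasConstant (chainSum ℓ S f) (chainForm ℓ k f) := by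
  induction ℓ generalizing k S with
  | zero =>
    induction f using MvPolynomial.induction_on' with
    | add p q hp hq =>
      rw [chainSum_add, map_add]
      exact hp.add hq
    | monomial u a =>
      have h1 : chainSum 0 S (monomial u a) = (a : FractionRing (MvPolynomial σ ℤ)) *
          completeSum S (u 0) := by
        rw [chainSum, completeSum, Finset.mul_sum]
        refine Finset.sum_bij' (fun b _ => b 0) (fun c _ => fun _ => c) ?_ ?_ ?_ ?_ ?_
        · intro b hb; exact (mem_injSeq.1 hb).2 0
        · intro c hc
          exact mem_injSeq.2 ⟨fun i j _ => Subsingleton.elim (α := Fin 1) i j, fun _ => hc⟩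
        · intro b _; ext j; rw [Fin.fin_one_eq_zero j]
        · intro c _; rfl
        · intro b _
          have h2 : S \ Finset.univ.image b = S.erase (b 0) := by
            ext c; simp [and_comm]
          have h3 : seqNumerator (monomial u a) b =
              (a : FractionRing (MvPolynomial σ ℤ)) * ratVar (b 0) ^ u 0 := by
            rw [monomial_eq, Finsupp.prod_fintype _ _ (by simp)]
            simp [seqNumerator, ratVar]
          rw [h2, h3, seqDenominator, Fin.prod_univ_zero, mul_one, mul_div_assoc]
      rw [h1]
      convert (HasConstant.of_poly (C a)).mul
        (hasConstant_completeSum (Finset.card_pos.1 (by omega : 0 < S.card)) (u 0)) using 1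
      · simp
      · simp only [chainForm, lcoeff_apply, coeff_monomial, hS, constantCoeff_C]
        have : u = Finsupp.single 0 k ↔ u 0 = k := by
          refine ⟨fun h => by simp [h], fun h => Finsupp.ext fun j => ?_⟩
          rw [Fin.fin_one_eq_zero j]; simp [h]
        simp [this]
  | succ ℓ ih =>
    obtain ⟨g, rfl⟩ := (finSuccEquiv ℤ (ℓ + 1)).symm.surjective f
    rw [chainForm_succ]
    induction g using Polynomial.induction_on' with
    | add p q hp hq =>
      rw [map_add, map_add, chainSum_add]
      exact hp.add hq
    | monomial i f =>
      rw [← Polynomial.C_mul_X_pow_eq_monomial, mul_comm, chainSum_succ, adjoinForm_X_pow_mul_C]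
      refine (ih (by omega) _).neg.add ?_
      exact hasConstant_splitSum (by omega)
        (fun A _ hA f => ih (by omega) f) i f

end Sequences

end

noncomputable section

open MvPolynomial

/-! ### Coefficients in the polynomial ring, and the complement of a sequence -/

section Coefficients

variable {σ : Type} [Fintype σ] [DecidableEq σ]

/-- The coefficients in ℤ[x] factor out of the sum over sequences, and at 0 only their constant
terms survive. -/
theorem hasConstant_sum_eval {ℓ k : ℕ} {S : Finset σ} (hS : S.card = k + (ℓ + 1))
    (F : MvPolynomial (Fin (ℓ + 1)) (MvPolynomial σ ℤ)) :
    HasConstant (∑ b ∈ injSeq ℓ S, algebraMap (MvPolynomial σ ℤ) (FractionRing (MvPolynomial σ ℤ))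
        (eval (fun j => X (b j)) F) /
          ((∏ a ∈ S \ Finset.univ.image b, (ratVar (b 0) - ratVar a)) * seqDenominator b))
      (chainForm ℓ k (map constantCoeff F)) := by
  induction F using MvPolynomial.induction_on' with
  | add p q hp hq =>
    simp only [map_add, add_div, Finset.sum_add_distrib]
    exact hp.add hq
  | monomial u a =>
    have h := (HasConstant.of_poly a).mul (hasConstant_chainSum hS (monomial u 1))
    convert h using 1
    · rw [chainSum, Finset.mul_sum]
      refine Finset.sum_congr rfl fun b _ => ?_
      rw [← mul_div_assoc, seqNumerator, ← map_mul, eval_monomial, monomial_eq]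
      simp [Finsupp.prod, -prod_X_pow_eq_monomial]
    · rw [map_monomial, ← smul_eq_mul, ← map_smul, smul_monomial, smul_eq_mul, mul_one]

theorem map_constantCoeff_mem_formRadical {ℓ k : ℕ} (hσ : Fintype.card σ = k + (ℓ + 1))
    {F : MvPolynomial (Fin (ℓ + 1)) (MvPolynomial σ ℤ)}
    (hF : ∀ b : Fin (ℓ + 1) → σ, Function.Injective b → eval (fun j => X (b j)) F = 0) :
    map constantCoeff F ∈ formRadical (chainForm ℓ k) := by
  intro g
  -- The test polynomial is lifted with constant coefficients, so that setting x = 0 returns it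
  -- unchanged.
  have h := hasConstant_sum_eval (S := Finset.univ) (by simpa using hσ) (F * map C g)
  rw [Finset.sum_eq_zero] at h
  · have h2 := h.unique HasConstant.zero
    rwa [map_mul, map_map, show (constantCoeff (R := ℤ) (σ := σ)).comp C = RingHom.id ℤ from
      RingHom.ext fun a => constantCoeff_C _ a, map_id] at h2
  · intro b hb
    rw [map_mul, hF b (mem_injSeq.1 hb).1, zero_mul, map_zero, zero_div]

/-- A polynomial in `t` whose value at `y_j = x_{b_j}` is the product of `t - x_a` over all `a`
which are not in the sequence `b`. -/
def complementPoly (σ : Type) [Fintype σ] (ℓ : ℕ) :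
    Polynomial (MvPolynomial (Fin (ℓ + 1)) (MvPolynomial σ ℤ)) :=
  (∏ a : σ, (Polynomial.X - Polynomial.C (C (X a)))) /ₘ
    ∏ j : Fin (ℓ + 1), (Polynomial.X - Polynomial.C (X j))

/-- Division by a monic polynomial commutes with evaluation. The division becomes exact only after
evaluation, the b_j being distinct elements of σ. -/
theorem map_complementPoly {ℓ : ℕ} {b : Fin (ℓ + 1) → σ} (hb : Function.Injective b) :
    (complementPoly σ ℓ).map (eval fun j => X (b j)) =
      ∏ a ∈ Finset.univ \ Finset.univ.image b, (Polynomial.X - Polynomial.C (X a)) := by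
  have hm : (∏ j : Fin (ℓ + 1), (Polynomial.X - Polynomial.C (X j)) :
      Polynomial (MvPolynomial (Fin (ℓ + 1)) (MvPolynomial σ ℤ))).Monic :=
    Polynomial.monic_prod_of_monic _ _ fun j _ => Polynomial.monic_X_sub_C _
  rw [complementPoly, Polynomial.map_divByMonic _ hm, Polynomial.map_prod, Polynomial.map_prod]
  simp only [Polynomial.map_sub, Polynomial.map_X, Polynomial.map_C, eval_C, eval_X]
  have h : ∏ a : σ, (Polynomial.X - Polynomial.C (X a : MvPolynomial σ ℤ)) =
      (∏ j : Fin (ℓ + 1), (Polynomial.X - Polynomial.C (X (b j)))) *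
        ∏ a ∈ Finset.univ \ Finset.univ.image b, (Polynomial.X - Polynomial.C (X a)) := by
    rw [← Finset.prod_sdiff (Finset.subset_univ (Finset.univ.image b)), mul_comm,
      Finset.prod_image hb.injOn]
  rw [h, Polynomial.mul_divByMonic_cancel_left]
  exact Polynomial.monic_prod_of_monic _ _ fun j _ => Polynomial.monic_X_sub_C _

theorem complementPoly_monic {σ : Type} [Fintype σ] {ℓ : ℕ} (h : ℓ + 1 ≤ Fintype.card σ) :
    (complementPoly σ ℓ).Monic ∧ (complementPoly σ ℓ).natDegree = Fintype.card σ - (ℓ + 1) := by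
  have hm : (∏ j : Fin (ℓ + 1), (Polynomial.X - Polynomial.C (X j)) :
      Polynomial (MvPolynomial (Fin (ℓ + 1)) (MvPolynomial σ ℤ))).Monic :=
    Polynomial.monic_prod_of_monic _ _ fun j _ => Polynomial.monic_X_sub_C _
  have hm' : (∏ a : σ, (Polynomial.X - Polynomial.C (C (X a))) :
      Polynomial (MvPolynomial (Fin (ℓ + 1)) (MvPolynomial σ ℤ))).Monic :=
    Polynomial.monic_prod_of_monic _ _ fun j _ => Polynomial.monic_X_sub_C _
  have hd : (∏ j : Fin (ℓ + 1), (Polynomial.X - Polynomial.C (X j)) :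
      Polynomial (MvPolynomial (Fin (ℓ + 1)) (MvPolynomial σ ℤ))).natDegree = ℓ + 1 := by
    rw [Polynomial.natDegree_prod_of_monic _ _ fun j _ => Polynomial.monic_X_sub_C _]
    simp
  have hd' : (∏ a : σ, (Polynomial.X - Polynomial.C (C (X a))) :
      Polynomial (MvPolynomial (Fin (ℓ + 1)) (MvPolynomial σ ℤ))).natDegree = Fintype.card σ := by
    rw [Polynomial.natDegree_prod_of_monic _ _ fun j _ => Polynomial.monic_X_sub_C _]
    simp
  constructor
  · rw [Polynomial.Monic, complementPoly, Polynomial.leadingCoeff_divByMonic_of_monic hm, hm']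
    rw [Polynomial.degree_eq_natDegree hm.ne_zero, Polynomial.degree_eq_natDegree hm'.ne_zero, hd,
      hd']
    exact_mod_cast h
  · rw [complementPoly, Polynomial.natDegree_divByMonic _ hm, hd, hd']

theorem finSuccEquiv_symm_eq_eval₂ {R : Type*} [CommRing R] {n : ℕ}
    (q : Polynomial (MvPolynomial (Fin n) R)) :
    (MvPolynomial.finSuccEquiv R n).symm q =
      q.eval₂ (rename (R := R) (Fin.succ : Fin n → Fin (n + 1))).toRingHom (X 0) := by
  rw [AlgEquiv.symm_apply_eq]
  induction q using Polynomial.induction_on' with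
  | add p q hp hq => rw [Polynomial.eval₂_add, map_add, ← hp, ← hq]
  | monomial i f =>
    rw [Polynomial.eval₂_monomial, map_mul, map_pow, finSuccEquiv_X_zero,
      ← Polynomial.C_mul_X_pow_eq_monomial]
    congr 1
    exact (finSuccEquiv_rename_succ f).symm

/-- The witness is `complementPoly` at x = 0. With the new variable put for t it vanishes on every
injective sequence, as b_0 is one of the colors missing from the rest. For k + ℓ + 2 colors its
degree is k + 1. -/
theorem exists_monic_mem_formRadical (ℓ k : ℕ) :
    ∃ p : Polynomial (MvPolynomial (Fin (ℓ + 1)) ℤ), p.Monic ∧ p.natDegree = k + 1 ∧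
      p ∈ formRadical (adjoinForm (X 0) (chainForm ℓ (k + 1)) (chainForm ℓ 0) k
        ((k + ℓ + 2).choose (k + 1))) := by
  obtain ⟨hm, hd⟩ := complementPoly_monic (σ := Fin (k + (ℓ + 2))) (ℓ := ℓ) (by simp; omega)
  set Q := complementPoly (Fin (k + (ℓ + 2))) ℓ with hQ
  refine ⟨Q.map (map constantCoeff), hm.map _, ?_, ?_⟩
  · rw [hm.natDegree_map, hd, Fintype.card_fin]
    omega
  intro g
  rw [← chainForm_succ, map_mul]
  have h : (MvPolynomial.finSuccEquiv ℤ (ℓ + 1)).symm (Q.map (map constantCoeff)) =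
      map constantCoeff ((MvPolynomial.finSuccEquiv _ (ℓ + 1)).symm Q) := by
    rw [finSuccEquiv_symm_eq_eval₂, finSuccEquiv_symm_eq_eval₂, Polynomial.eval₂_map,
      Polynomial.hom_eval₂, map_X]
    congr 1
    ext <;> simp
  rw [h]
  refine map_constantCoeff_mem_formRadical (σ := Fin (k + (ℓ + 2))) (by simp) ?_ _
  intro b hb
  have hb' : Function.Injective (fun j => b (Fin.succ j)) := hb.comp (Fin.succ_injective _)
  rw [finSuccEquiv_symm_eq_eval₂, Polynomial.hom_eval₂, eval_X]
  have h2 : ((eval fun j => (X (b j) : MvPolynomial (Fin (k + (ℓ + 2))) ℤ)).comp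
      (rename (R := MvPolynomial (Fin (k + (ℓ + 2))) ℤ)
        (Fin.succ : Fin (ℓ + 1) → Fin (ℓ + 2))).toRingHom) = eval fun j => X (b (Fin.succ j)) := by
    ext <;> simp
  rw [h2, ← Polynomial.eval_map, map_complementPoly hb', Polynomial.eval_prod]
  refine Finset.prod_eq_zero (i := b 0) ?_ (by simp)
  simp only [Finset.mem_sdiff, Finset.mem_univ, Finset.mem_image, true_and, not_exists]
  exact fun j hj => Fin.succ_ne_zero j (hb hj)

end Coefficients

/-! ### A basis modulo the radical of `chainForm` -/

theorem IsBasisModRadical.of_forall {P ι : Type*} [CommRing P] [Fintype ι] {τ : P →ₗ[ℤ] ℤ}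
    {b : ι → P} (h : ∀ c : ι → ℤ, ∑ i, c i • b i ∈ formRadical τ → ∀ i, c i = 0)
    (h' : ∀ f, ∃ c : ι → ℤ, f - ∑ i, c i • b i ∈ formRadical τ) : IsBasisModRadical τ b where
  linearIndependent := by
    rw [Fintype.linearIndependent_iff]
    intro c hc
    refine h c ?_
    rw [← Ideal.Quotient.eq_zero_iff_mem, ← hc, map_sum]
    simp
  span_eq_top := by
    rw [eq_top_iff]
    rintro x -
    obtain ⟨f, rfl⟩ := Ideal.Quotient.mk_surjective x
    obtain ⟨c, hc⟩ := h' f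
    rw [← Ideal.Quotient.eq] at hc
    rw [hc, map_sum]
    refine Submodule.sum_mem _ fun i _ => ?_
    rw [map_zsmul]
    exact Submodule.smul_mem _ _ (Submodule.subset_span ⟨i, rfl⟩)

theorem IsBasisModRadical.map_equiv {P Q ι : Type*} [CommRing P] [CommRing Q] [Fintype ι]
    {τ : P →ₗ[ℤ] ℤ} {τ' : Q →ₗ[ℤ] ℤ} {b : ι → P} (h : IsBasisModRadical τ b) (e : P ≃+* Q)
    (he : ∀ f, τ' (e f) = τ f) : IsBasisModRadical τ' fun i => e (b i) := by
  have hmem : ∀ f, e f ∈ formRadical τ' ↔ f ∈ formRadical τ := by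
    intro f
    rw [mem_formRadical, mem_formRadical, e.surjective.forall]
    simp only [← map_mul, he]
  refine of_forall (fun c hc => h.eq_zero_of_sum_mem ?_) fun f => ?_
  · rw [← hmem]
    simpa using hc
  · obtain ⟨f, rfl⟩ := e.surjective f
    obtain ⟨c, hc⟩ := h.exists_sub_mem f
    refine ⟨c, ?_⟩
    rw [← hmem] at hc
    simpa using hc

theorem mem_formRadical_chainForm_zero {k : ℕ} {f : MvPolynomial (Fin 1) ℤ} :
    f ∈ formRadical (chainForm 0 k) ↔ ∀ i ≤ k, coeff (Finsupp.single 0 i) f = 0 := by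
  constructor
  · intro h i hi
    -- Multiplication by y^(k-i) moves the coefficient of y^i to y^k, where the form reads it.
    have h1 := h (monomial (Finsupp.single 0 (k - i)) 1)
    simp only [chainForm, lcoeff_apply] at h1
    rw [coeff_mul_monomial', if_pos, mul_one, ← Finsupp.single_tsub,
      show k - (k - i) = i by omega] at h1
    · exact h1
    · rw [Finsupp.single_le_single]; omega
  · intro h g
    induction g using MvPolynomial.induction_on' with
    | add p q hp hq => rw [mul_add, map_add, hp, hq, add_zero]
    | monomial u a =>
      simp only [chainForm, lcoeff_apply]
      rw [coeff_mul_monomial']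
      split_ifs with hu
      · have : Finsupp.single 0 k - u = Finsupp.single 0 (k - u 0) := by
          ext j
          rw [Fin.fin_one_eq_zero j]
          simp
        rw [this, h _ (by omega), zero_mul]
      · rfl

/-- The monomials `y_0 ^ i * y_1 ^ ε_1 * ⋯ * y_ℓ ^ ε_ℓ` with `i ≤ k` and `ε_j ≤ 1` form a basis
modulo the radical of `chainForm ℓ k`. -/
theorem isBasisModRadical_chainForm (ℓ k : ℕ) : IsBasisModRadical (chainForm ℓ k)
    fun t : Fin (k + 1) × (Fin ℓ → Fin 2) =>
      X 0 ^ (t.1 : ℕ) * ∏ j : Fin ℓ, X j.succ ^ (t.2 j : ℕ) := by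
  induction ℓ generalizing k with
  | zero =>
    have h : IsBasisModRadical (chainForm 0 k) fun i : Fin (k + 1) => X 0 ^ (i : ℕ) := by
      have hcoeff : ∀ (c : Fin (k + 1) → ℤ) (i : Fin (k + 1)),
          coeff (Finsupp.single 0 (i : ℕ)) (∑ j, c j • (X 0 ^ (j : ℕ) : MvPolynomial (Fin 1) ℤ)) =
            c i := by
        intro c i
        rw [coeff_sum, Finset.sum_eq_single i]
        · rw [coeff_smul, coeff_X_pow, if_pos rfl, smul_eq_mul, mul_one]
        · intro j _ hj
          rw [coeff_smul, coeff_X_pow, if_neg, smul_zero]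
          intro h
          exact hj (Fin.ext (Finsupp.single_injective _ h))
        · simp
      refine IsBasisModRadical.of_forall (fun c hc i => ?_)
        fun f => ⟨fun i => coeff (Finsupp.single 0 (i : ℕ)) f, ?_⟩
      · rw [← hcoeff c i]
        exact mem_formRadical_chainForm_zero.1 hc i (by omega)
      · rw [mem_formRadical_chainForm_zero]
        intro i hi
        rw [coeff_sub, hcoeff _ ⟨i, by omega⟩, sub_self]
    convert h.comp_equiv (Equiv.prodUnique (Fin (k + 1)) (Fin 0 → Fin 2)) using 2
    simp
  | succ ℓ ih =>
    -- For k = 0 the exponent of y_0 can only be 0 and disappears from the index.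
    have h₀ : IsBasisModRadical (chainForm ℓ 0)
        fun T : Fin ℓ → Fin 2 => ∏ j : Fin ℓ, X j.succ ^ (T j : ℕ) := by
      convert (ih 0).comp_equiv (Equiv.uniqueProd (Fin ℓ → Fin 2) (Fin 1)).symm using 2
      simp
    have h := isBasisModRadical_adjoinForm (k := k) (c := (k + ℓ + 2).choose (k + 1))
      (by exact_mod_cast (Nat.choose_pos (by omega)).ne') (exists_monic_mem_formRadical ℓ k) h₀
      (ih (k + 1))
    -- The former y_0 is now y_1: its exponent, at most 1, becomes the first entry of the longer
    -- sequence ε.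
    have h2 := (h.map_equiv (MvPolynomial.finSuccEquiv ℤ (ℓ + 1)).symm.toRingEquiv
      (τ' := chainForm (ℓ + 1) k) (fun f => chainForm_succ f)).comp_equiv
      ((Equiv.refl (Fin (k + 1))).prodCongr (Fin.consEquiv fun _ : Fin (ℓ + 1) => Fin 2).symm)
    convert h2 using 2 with t
    simp only [Function.comp_apply]
    symm
    refine (AlgEquiv.symm_apply_eq _).2 ?_
    simp [Fin.prod_univ_succ, finSuccEquiv_X_succ, finSuccEquiv_X_zero, Fin.consEquiv, Fin.tail,
      -Fin.succ_zero_eq_one, -Fin.succ_zero_eq_one']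

end

namespace VinylGraph

noncomputable section

open MvPolynomial

variable {Γ : VinylGraph} {R : Type} [CommRing R]

/-! ### Numerators and denominators -/

theorem Coloring.numerator_tprod (c : Γ.Coloring)
    (p : (e : Γ.Edge) → symmetricSubalgebra (Fin (Γ.label e)) R) :
    c.numerator R (PiTensorProduct.tprod R p : Γ.DecoratedSpace R) =
      ∏ e, c.substitute R e (p e) := by
  unfold Coloring.numerator
  erw [PiTensorProduct.liftAlgHom_apply]
  erw [PiTensorProduct.lift.tprod]
  simp

theorem Coloring.numerator_algebraMap (c : Γ.Coloring) (a : R) :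
    c.numerator R (algebraMap R (Γ.DecoratedSpace R) a) = C a :=
  (c.numerator R).commutes a

theorem DecoratedSpace.induction {motive : Γ.DecoratedSpace R → Prop}
    (tprod : ∀ (a : R) (p : (e : Γ.Edge) → symmetricSubalgebra (Fin (Γ.label e)) R),
      motive (algebraMap R (Γ.DecoratedSpace R) a *
        (show Γ.DecoratedSpace R from PiTensorProduct.tprod R p)))
    (add : ∀ x y, motive x → motive y → motive (x + y)) (x : Γ.DecoratedSpace R) : motive x :=
  PiTensorProduct.induction_on (motive := motive) x
    (fun a p => by
      have h := tprod a p
      rw [← Algebra.smul_def] at h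
      exact h) add

theorem Coloring.numerator_isHomogeneous (c : Γ.Coloring) (d : Γ.Decoration R) :
    (c.numerator R d.toSpace).IsHomogeneous
      (∑ e, (d.poly e : MvPolynomial (Fin (Γ.label e)) R).totalDegree) := by
  rw [Decoration.toSpace, Coloring.numerator_tprod]
  refine IsHomogeneous.prod _ _ _ fun e _ => ?_
  refine IsHomogeneous.rename_isHomogeneous ?_
  change (d.poly e : MvPolynomial (Fin (Γ.label e)) R).IsHomogeneous _
  by_cases h : (d.poly e : MvPolynomial (Fin (Γ.label e)) R) = 0
  · rw [h]
    exact isHomogeneous_zero _ _ _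
  · obtain ⟨m, hm⟩ := d.homogeneous e
    rw [hm.totalDegree h]
    exact hm

/-- Labels add at a vertex, so the two color sets and their union leave no room for an overlap. -/
theorem Coloring.disjoint_split (c : Γ.Coloring) (v : Γ.Split) :
    Disjoint (c.1 (Γ.data.splitLeft v)) (c.1 (Γ.data.splitRight v)) := by
  rw [← Finset.card_union_eq_card_add_card, ← c.2.split, c.2.card_eq, c.2.card_eq, c.2.card_eq,
    Γ.label_split]

theorem Coloring.denominator_isHomogeneous (c : Γ.Coloring) :
    (c.denominator R).IsHomogeneous Γ.splitWeight := by
  refine IsHomogeneous.prod _ _ _ fun v _ => ?_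
  rw [← c.2.card_eq, ← c.2.card_eq, ← smul_eq_mul, ← Finset.sum_const]
  refine IsHomogeneous.prod _ _ _ fun i _ => ?_
  rw [Finset.card_eq_sum_ones]
  exact IsHomogeneous.prod _ _ _ fun j _ => (isHomogeneous_X R i).sub (isHomogeneous_X R j)

/-- The exponent s already has the degree of p, so every nonconstant term of q overshoots. -/
theorem coeff_mul_of_isHomogeneous {σ : Type*} {q p : MvPolynomial σ R} {m : ℕ}
    (hp : p.IsHomogeneous m) {s : σ →₀ ℕ} (hs : coeff s p ≠ 0) :
    coeff s (q * p) = constantCoeff q * coeff s p := by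
  classical
  rw [coeff_mul, Finset.sum_eq_single (0, s)]
  · rfl
  · rintro ⟨u, v⟩ huv hne
    rw [Finset.HasAntidiagonal.mem_antidiagonal] at huv
    by_contra h
    have hv : coeff v p ≠ 0 := fun h' => h (by simp [h'])
    have h1 : v.degree = m := by_contra fun h' => hv (hp.coeff_eq_zero h')
    have h2 : s.degree = m := by_contra fun h' => hs (hp.coeff_eq_zero h')
    simp only at huv
    have h3 : u.degree = 0 := by
      have := congrArg Finsupp.degree huv
      rw [map_add] at this
      omega
    rw [Finsupp.degree_eq_zero_iff] at h3
    subst h3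
    rw [zero_add] at huv
    exact hne (by rw [huv])
  · simp

/-! ### Decorations by monomials -/

/-- The decoration of each edge `e` by the power `ε e` of the product of all its variables. -/
def monomialDecoration (ε : Γ.Edge → ℕ) : Γ.Decoration R where
  poly e := ⟨∏ i, X i ^ ε e, by
    rw [mem_symmetricSubalgebra]
    intro s
    rw [map_prod]
    simp only [map_pow, rename_X]
    exact Equiv.prod_comp s fun i => (X i ^ ε e : MvPolynomial (Fin (Γ.label e)) R)⟩
  homogeneous e := ⟨∑ _i : Fin (Γ.label e), ε e,
    IsHomogeneous.prod _ _ _ fun i _ => isHomogeneous_X_pow i (ε e)⟩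

theorem coe_monomialDecoration_poly (ε : Γ.Edge → ℕ) (e : Γ.Edge) :
    ((monomialDecoration ε : Γ.Decoration R).poly e : MvPolynomial (Fin (Γ.label e)) R) =
      ∏ i, X i ^ ε e := rfl

theorem Coloring.numerator_monomialDecoration (c : Γ.Coloring) (ε : Γ.Edge → ℕ) :
    c.numerator R (monomialDecoration ε).toSpace = ∏ e, ∏ a ∈ c.1 e, X a ^ ε e := by
  rw [Decoration.toSpace, Coloring.numerator_tprod]
  refine Finset.prod_congr rfl fun e _ => ?_
  have h : c.substitute R e ((monomialDecoration ε).poly e) =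
      rename ((c.1 e).orderEmbOfFin (c.2.card_eq e)) (∏ i, X i ^ ε e) := rfl
  rw [h, map_prod]
  simp only [map_pow, rename_X]
  conv_rhs => rw [← Finset.map_orderEmbOfFin_univ (c.1 e) (c.2.card_eq e), Finset.prod_map]
  rfl

theorem Decoration.ext_poly {d d' : Γ.Decoration R} (h : d.poly = d'.poly) : d = d' := by
  cases d; cases d'; congr

theorem isSchur_iff_of_eq_one {a : ℕ} (ha : a = 1) (μ : Fin a → ℕ) (p : MvPolynomial (Fin a) R) :
    IsSchur μ p ↔ p = ∏ i, X i ^ μ i := by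
  subst ha
  simp [IsSchur]

/-- If all right edges of split vertices have label `1`, then the d.u.r. set consists of monomial
decorations of these edges. -/
theorem mem_dur_iff (hΓ : ∀ v, Γ.label (Γ.data.splitRight v) = 1) (d : Γ.Decoration R) :
    d ∈ Γ.dur R ↔ ∃ ε : Γ.Edge → ℕ,
      (∀ v, ε (Γ.data.splitRight v) ≤ Γ.label (Γ.data.splitLeft v)) ∧
      (∀ e, (∀ v, e ≠ Γ.data.splitRight v) → ε e = 0) ∧ d = monomialDecoration ε := by
  classical
  constructor
  · rintro ⟨h1, h2⟩
    choose μ hanti hle hschur using h1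
    have hinj : Function.Injective Γ.data.splitRight := fun v w h => by
      have := @Γ.outgoing_injective (Sum.inr (Sum.inl v)) (Sum.inr (Sum.inl w)) h
      simpa using this
    have hpos : ∀ v, 0 < Γ.label (Γ.data.splitRight v) := fun v => Γ.label_pos _
    let ε : Γ.Edge → ℕ := fun e =>
      if h : ∃ v, e = Γ.data.splitRight v then μ h.choose ⟨0, hpos _⟩ else 0
    have hε : ∀ v, ε (Γ.data.splitRight v) = μ v ⟨0, hpos v⟩ := by
      intro v
      have h : ∃ w, Γ.data.splitRight v = Γ.data.splitRight w := ⟨v, rfl⟩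
      have hv : h.choose = v := (hinj h.choose_spec).symm
      simp only [ε, dif_pos h]
      rw [hv]
    have hε' : ∀ e, (∀ v, e ≠ Γ.data.splitRight v) → ε e = 0 := by
      intro e he
      simp only [ε]
      rw [dif_neg]
      rintro ⟨v, hv⟩
      exact he v hv
    refine ⟨ε, fun v => by rw [hε]; exact hle v _, hε', Decoration.ext_poly (funext fun e => ?_)⟩
    apply Subtype.ext
    by_cases h : ∃ v, e = Γ.data.splitRight v
    · obtain ⟨v, rfl⟩ := h
      rw [(isSchur_iff_of_eq_one (hΓ v) _ _).1 (hschur v)]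
      refine Finset.prod_congr rfl fun i _ => ?_
      rw [hε]
      congr 2
      apply Fin.ext
      have := i.2
      have := hΓ v
      simp only
      omega
    · push Not at h
      rw [h2 e h]
      rw [coe_monomialDecoration_poly, hε' e h]
      simp
  · rintro ⟨ε, hle, h0, rfl⟩
    refine ⟨fun v => ⟨fun _ => ε (Γ.data.splitRight v), fun _ _ _ => le_rfl, fun _ => hle v, ?_⟩,
      fun e he => ?_⟩
    · rw [isSchur_iff_of_eq_one (hΓ v)]
      rfl
    · apply Subtype.ext
      rw [coe_monomialDecoration_poly, h0 e he]
      simp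

variable [IsDomain R]

theorem Coloring.denominator_ne_zero (c : Γ.Coloring) : c.denominator R ≠ 0 := by
  refine Finset.prod_ne_zero_iff.2 fun v _ => Finset.prod_ne_zero_iff.2 fun i hi =>
    Finset.prod_ne_zero_iff.2 fun j hj => sub_ne_zero.2 fun h => ?_
  exact Finset.disjoint_left.1 (c.disjoint_split v) hi (X_injective h ▸ hj)

variable (R) in
/-- The `∞`-evaluation as a sum over all colorings. -/
def evalRat (x : Γ.DecoratedSpace R) : FractionRing (MvPolynomial (Fin Γ.level) R) :=
  ∑ c : Γ.Coloring, algebraMap (MvPolynomial (Fin Γ.level) R) _ (c.numerator R x) /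
    algebraMap (MvPolynomial (Fin Γ.level) R) _ (c.denominator R)

theorem evalInfty_apply (x : Γ.DecoratedSpace R) : Γ.evalInfty R x = evalRat R x := by
  rw [evalInfty, LinearMap.sum_apply]
  refine Finset.sum_congr rfl fun c _ => ?_
  rw [div_eq_inv_mul]
  rfl

variable (R) in
/-- The `∞`-evaluation of `x` is a polynomial which vanishes at `0`. -/
def EvalVanishes (x : Γ.DecoratedSpace R) : Prop :=
  ∃ q : MvPolynomial (Fin Γ.level) R, algebraMap _ (FractionRing _) q = evalRat R x ∧
    constantCoeff q = 0

theorem mem_pairingKer {x : Γ.DecoratedSpace R} {d : Γ.Decoration R} :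
    x ∈ Γ.pairingKer R d ↔ EvalVanishes R (x * d.toSpace) := by
  have h : x ∈ Γ.pairingKer R d ↔ ∃ q : MvPolynomial (Fin Γ.level) R,
      aeval (0 : Fin Γ.level → R) q = 0 ∧
        Γ.polyToRat R q = Γ.evalInfty R (x * d.toSpace) := Iff.rfl
  rw [h, EvalVanishes, evalInfty_apply]
  refine exists_congr fun q => ?_
  rw [and_comm, aeval_zero]
  rfl

/-! ### The grading -/

/-- A polynomial value would have degree m - t_Γ. Clearing denominators by their product P makes
this precise: a nonzero constant term would put a term of the degree of P into qP, which is
homogeneous of another degree. -/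
theorem evalVanishes_of_ne {x : Γ.DecoratedSpace R} {m : ℕ}
    (hx : ∃ q : MvPolynomial (Fin Γ.level) R, algebraMap _ (FractionRing _) q = evalRat R x)
    (hm : ∀ c : Γ.Coloring, (c.numerator R x).IsHomogeneous m) (hne : m ≠ Γ.splitWeight) :
    EvalVanishes R x := by
  classical
  obtain ⟨q, hq⟩ := hx
  refine ⟨q, hq, ?_⟩
  set P : MvPolynomial (Fin Γ.level) R := ∏ c : Γ.Coloring, c.denominator R with hP
  have hP0 : P ≠ 0 := Finset.prod_ne_zero_iff.2 fun c _ => c.denominator_ne_zero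
  have hPh : P.IsHomogeneous (∑ _c : Γ.Coloring, Γ.splitWeight) :=
    IsHomogeneous.prod _ _ _ fun c _ => c.denominator_isHomogeneous
  have hqP : q * P = ∑ c : Γ.Coloring, c.numerator R x *
      ∏ c' ∈ Finset.univ.erase c, c'.denominator R := by
    apply IsFractionRing.injective (MvPolynomial (Fin Γ.level) R)
      (FractionRing (MvPolynomial (Fin Γ.level) R))
    rw [map_mul, hq, evalRat, map_sum, Finset.sum_mul]
    refine Finset.sum_congr rfl fun c _ => ?_
    have hc : algebraMap _ (FractionRing (MvPolynomial (Fin Γ.level) R)) (c.denominator R) ≠ 0 := by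
      rw [Ne, IsFractionRing.to_map_eq_zero_iff]
      exact c.denominator_ne_zero
    rw [hP, ← Finset.mul_prod_erase _ _ (Finset.mem_univ c), map_mul, map_mul, ← mul_assoc,
      div_mul_cancel₀ _ hc]
  obtain ⟨s, hs⟩ := exists_coeff_ne_zero hP0
  have h1 := coeff_mul_of_isHomogeneous (q := q) hPh hs
  by_contra hq0
  rw [hqP, coeff_sum] at h1
  have h2 : s.degree = ∑ _c : Γ.Coloring, Γ.splitWeight :=
    by_contra fun h' => hs (hPh.coeff_eq_zero h')
  rw [Finset.sum_eq_zero] at h1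
  · exact mul_ne_zero hq0 hs h1.symm
  · intro c _
    have h3 : (c.numerator R x * ∏ c' ∈ Finset.univ.erase c, c'.denominator R).IsHomogeneous
        (m + ∑ _c' ∈ Finset.univ.erase c, Γ.splitWeight) :=
      (hm c).mul (IsHomogeneous.prod _ _ _ fun c _ => c.denominator_isHomogeneous)
    refine h3.coeff_eq_zero ?_
    rw [h2, ← Finset.add_sum_erase _ _ (Finset.mem_univ c)]
    omega

theorem evalVanishes_mul_of_degree_ne
    (hpoly : ∀ x : Γ.DecoratedSpace R, ∃ q : MvPolynomial (Fin Γ.level) R,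
      algebraMap _ (FractionRing _) q = evalRat R x) {d g : Γ.Decoration R}
    (h : d.degree + g.degree ≠ 0) : EvalVanishes R (d.toSpace * g.toSpace) := by
  refine evalVanishes_of_ne (hpoly _) (fun c => ?_) ?_
    (m := ∑ e, (d.poly e : MvPolynomial (Fin (Γ.label e)) R).totalDegree +
      ∑ e, (g.poly e : MvPolynomial (Fin (Γ.label e)) R).totalDegree)
  · rw [map_mul]
    exact (c.numerator_isHomogeneous d).mul (c.numerator_isHomogeneous g)
  · intro h'
    apply h
    rw [Decoration.degree, Decoration.degree, ← h']
    push_cast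
    ring

/-- A decoration g pairs to zero with every graded part except the one of degree -deg g. An element
of one part and of the span of the others is thus killed by all g. -/
theorem iSupIndep_gradedPart
    (hpoly : ∀ x : Γ.DecoratedSpace R, ∃ q : MvPolynomial (Fin Γ.level) R,
      algebraMap _ (FractionRing _) q = evalRat R x) : iSupIndep (Γ.gradedPart R) := by
  set N := ⨅ d : Γ.Decoration R, Γ.pairingKer R d with hN
  have hle : ∀ (m : ℤ) (g : Γ.Decoration R), m + g.degree ≠ 0 →
      Γ.gradedPart R m ≤ (Γ.pairingKer R g).map N.mkQ := by
    intro m g hmg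
    refine Submodule.span_le.2 ?_
    rintro _ ⟨d, rfl, rfl⟩
    exact ⟨d.toSpace, mem_pairingKer.2 (evalVanishes_mul_of_degree_ne hpoly hmg), rfl⟩
  intro m
  rw [Submodule.disjoint_def]
  intro x hx hx'
  have hall : ∀ g : Γ.Decoration R, x ∈ (Γ.pairingKer R g).map N.mkQ := by
    intro g
    by_cases hg : m + g.degree = 0
    · refine (iSup₂_le fun j hj => hle j g ?_) hx'
      omega
    · exact hle m g hg hx
  obtain ⟨y, rfl⟩ := N.mkQ_surjective x
  rw [Submodule.mkQ_apply, Submodule.Quotient.mk_eq_zero, hN, Submodule.mem_iInf]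
  intro g
  obtain ⟨z, hz, hzy⟩ := hall g
  have h1 : z - y ∈ N := (Submodule.Quotient.eq N).1 hzy
  have h2 : z - y ∈ Γ.pairingKer R g := (Submodule.mem_iInf _).1 (hN ▸ h1) g
  simpa using Submodule.sub_mem _ hz h2

/-- A criterion for a graph to be a d.u.r. graph. -/
theorem isDurGraph_of_forall {ι : Type*} [Fintype ι]
    (hpoly : ∀ x : Γ.DecoratedSpace R, ∃ q : MvPolynomial (Fin Γ.level) R,
      algebraMap _ (FractionRing _) q = evalRat R x)
    (D : ι → Γ.Decoration R) (hD : Set.range D = Γ.dur R) (hinj : Function.Injective D)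
    (hindep : ∀ c : ι → R, (∀ g : Γ.Decoration R, EvalVanishes R
      ((∑ i, algebraMap R _ (c i) * (D i).toSpace) * g.toSpace)) → ∀ i, c i = 0)
    (hspan : ∀ x : Γ.DecoratedSpace R, ∃ c : ι → R, ∀ g : Γ.Decoration R, EvalVanishes R
      ((x - ∑ i, algebraMap R _ (c i) * (D i).toSpace) * g.toSpace)) :
    Γ.IsDurGraph R := by
  have hspan' : Submodule.span R (Set.range fun i => (D i).toState) = ⊤ := by
    rw [eq_top_iff]
    rintro x -
    obtain ⟨y, rfl⟩ := Submodule.Quotient.mk_surjective _ x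
    obtain ⟨c, hc⟩ := hspan y
    have h1 : y - ∑ i, c i • (D i).toSpace ∈ ⨅ d : Γ.Decoration R, Γ.pairingKer R d := by
      rw [Submodule.mem_iInf]
      intro g
      rw [mem_pairingKer]
      simpa only [Algebra.smul_def] using hc g
    rw [(Submodule.Quotient.eq _).2 h1, ← Submodule.mkQ_apply, map_sum]
    refine Submodule.sum_mem _ fun i _ => ?_
    rw [map_smul]
    exact Submodule.smul_mem _ _ (Submodule.subset_span ⟨i, rfl⟩)
  have hrange : (Set.range fun d : Γ.dur R => d.1.toState) = Set.range fun i => (D i).toState := by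
    ext x
    simp only [Set.mem_range, Subtype.exists, ← hD]
    constructor
    · rintro ⟨_, ⟨i, rfl⟩, rfl⟩
      exact ⟨i, rfl⟩
    · rintro ⟨i, rfl⟩
      exact ⟨D i, ⟨i, rfl⟩, rfl⟩
  have hhom : ∀ d : Γ.Decoration R, d.toState ∈ Γ.gradedPart R d.degree :=
    fun d => Submodule.subset_span ⟨d, rfl, rfl⟩
  refine ⟨fun x => ?_, ?_, fun d _ => hhom d, ?_, hrange ▸ hspan'⟩
  · obtain ⟨q, hq⟩ := hpoly x
    exact ⟨q, hq.trans (evalInfty_apply x).symm⟩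
  · rw [DirectSum.isInternal_submodule_iff_iSupIndep_and_iSup_eq_top]
    refine ⟨iSupIndep_gradedPart hpoly, ?_⟩
    rw [eq_top_iff, ← hspan', Submodule.span_le]
    rintro _ ⟨i, rfl⟩
    exact Submodule.mem_iSup_of_mem _ (hhom (D i))
  · have hlin : LinearIndependent R fun i => (D i).toState := by
      rw [Fintype.linearIndependent_iff]
      intro c hc
      refine hindep c fun g => ?_
      have h1 : ∑ i, c i • (D i).toSpace ∈ ⨅ d : Γ.Decoration R, Γ.pairingKer R d := by
        rw [← Submodule.Quotient.mk_eq_zero, ← hc, ← Submodule.mkQ_apply, map_sum]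
        exact Finset.sum_congr rfl fun i _ => map_smul _ _ _
      rw [Submodule.mem_iInf] at h1
      simpa only [Algebra.smul_def] using mem_pairingKer.1 (h1 g)
    let e : Γ.dur R ≃ ι := ((Equiv.ofInjective D hinj).trans (Equiv.setCongr hD)).symm
    have he : ∀ d, D (e d) = d.1 := by
      intro d
      obtain ⟨i, rfl⟩ := e.symm.surjective d
      rw [Equiv.apply_symm_apply]
      rfl
    have h2 := hlin.comp e e.injective
    convert h2 using 2 with d
    simp only [Function.comp_apply, he]

theorem monomialDecoration_injective :
    Function.Injective (monomialDecoration : (Γ.Edge → ℕ) → Γ.Decoration R) := by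
  intro ε ε' h
  funext e
  have h1 : ∏ i : Fin (Γ.label e), (X i : MvPolynomial (Fin (Γ.label e)) R) ^ ε e =
      ∏ i, X i ^ ε' e := by
    rw [← coe_monomialDecoration_poly, h, coe_monomialDecoration_poly]
  have h2 : ∀ m : ℕ, ∏ i : Fin (Γ.label e), (X i : MvPolynomial (Fin (Γ.label e)) R) ^ m =
      monomial (Finsupp.equivFunOnFinite.symm fun _ => m) 1 := by
    intro m
    rw [monomial_eq, Finsupp.prod_fintype _ _ (by simp)]
    simp
  rw [h2, h2] at h1
  have h3 := monomial_left_injective (one_ne_zero (α := R)) h1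
  exact DFunLike.congr_fun h3 ⟨0, Γ.label_pos e⟩

end

end VinylGraph

/-! ### From colorings by sequences to the d.u.r. basis -/

namespace VinylGraph

noncomputable section

open MvPolynomial

variable {Γ : VinylGraph} {ℓ k : ℕ}

/-- A description of the colorings of `Γ` by the sequences of `ℓ + 1` distinct colors of a family of
edges `strand`, with denominators as in `chainSum`. -/
structure ChainModel (Γ : VinylGraph) (ℓ k : ℕ) where
  level_eq : Γ.level = k + (ℓ + 1)
  strand : Fin (ℓ + 1) → Γ.Edge
  strand_injective : Function.Injective strand
  seq : Γ.Coloring → Fin (ℓ + 1) → Fin Γ.level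
  seq_injective : Function.Injective seq
  injective_seq : ∀ c, Function.Injective (seq c)
  exists_seq : ∀ b : Fin (ℓ + 1) → Fin Γ.level, Function.Injective b → ∃ c, seq c = b
  color_strand : ∀ c j, c.1 (strand j) = {seq c j}
  edgePoly : ∀ e, ∃ W : Polynomial (MvPolynomial (Fin (ℓ + 1)) (MvPolynomial (Fin Γ.level) ℤ)),
    ∀ c : Γ.Coloring, W.map (eval fun j => X (seq c j)) =
      ∏ a ∈ c.1 e, (Polynomial.X - Polynomial.C (X a))
  sign : ℤˣ
  denominator_eq : ∀ c : Γ.Coloring,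
    algebraMap (MvPolynomial (Fin Γ.level) ℤ) (FractionRing (MvPolynomial (Fin Γ.level) ℤ))
      (c.denominator ℤ) = ((sign : ℤ) : FractionRing (MvPolynomial (Fin Γ.level) ℤ)) *
        ((∏ a ∈ Finset.univ \ Finset.univ.image (seq c), (ratVar (seq c 0) - ratVar a)) *
          seqDenominator (seq c))
  label_splitRight : ∀ v, Γ.label (Γ.data.splitRight v) = 1
  dur_exponents : ∀ ε : Γ.Edge → ℕ,
    ((∀ v, ε (Γ.data.splitRight v) ≤ Γ.label (Γ.data.splitLeft v)) ∧
      ∀ e, (∀ v, e ≠ Γ.data.splitRight v) → ε e = 0) ↔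
    ((ε (strand 0) ≤ k ∧ ∀ j : Fin ℓ, ε (strand j.succ) ≤ 1) ∧
      ∀ e, (∀ j, e ≠ strand j) → ε e = 0)

namespace ChainModel

variable (M : ChainModel Γ ℓ k)

/-- The polynomial `F` gives the numerators of `x` for all colorings. -/
def Represents (x : Γ.DecoratedSpace ℤ)
    (F : MvPolynomial (Fin (ℓ + 1)) (MvPolynomial (Fin Γ.level) ℤ)) : Prop :=
  ∀ c : Γ.Coloring, c.numerator ℤ x = eval (fun j => X (M.seq c j)) F

variable {M}

theorem Represents.add {x y : Γ.DecoratedSpace ℤ}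
    {F G : MvPolynomial (Fin (ℓ + 1)) (MvPolynomial (Fin Γ.level) ℤ)}
    (hx : M.Represents x F) (hy : M.Represents y G) : M.Represents (x + y) (F + G) :=
  fun c => by rw [map_add, map_add, hx, hy]

theorem Represents.sub {x y : Γ.DecoratedSpace ℤ}
    {F G : MvPolynomial (Fin (ℓ + 1)) (MvPolynomial (Fin Γ.level) ℤ)}
    (hx : M.Represents x F) (hy : M.Represents y G) : M.Represents (x - y) (F - G) :=
  fun c => by rw [map_sub, map_sub, hx, hy]

theorem Represents.mul {x y : Γ.DecoratedSpace ℤ}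
    {F G : MvPolynomial (Fin (ℓ + 1)) (MvPolynomial (Fin Γ.level) ℤ)}
    (hx : M.Represents x F) (hy : M.Represents y G) : M.Represents (x * y) (F * G) :=
  fun c => by rw [map_mul, map_mul, hx, hy]

theorem Represents.sum {ι : Type*} {s : Finset ι} {x : ι → Γ.DecoratedSpace ℤ}
    {F : ι → MvPolynomial (Fin (ℓ + 1)) (MvPolynomial (Fin Γ.level) ℤ)}
    (h : ∀ i ∈ s, M.Represents (x i) (F i)) : M.Represents (∑ i ∈ s, x i) (∑ i ∈ s, F i) :=
  fun c => by
    rw [map_sum, map_sum]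
    exact Finset.sum_congr rfl fun i hi => h i hi c

theorem represents_algebraMap (a : ℤ) :
    M.Represents (algebraMap ℤ (Γ.DecoratedSpace ℤ) a) (C (C a)) :=
  fun c => by rw [Coloring.numerator_algebraMap, eval_C]

variable (M)

theorem exists_eval_eq_esymm (e : Γ.Edge) (i : ℕ) (hi : i ≤ Γ.label e) :
    ∃ F : MvPolynomial (Fin (ℓ + 1)) (MvPolynomial (Fin Γ.level) ℤ), ∀ c : Γ.Coloring,
      rename ((c.1 e).orderEmbOfFin (c.2.card_eq e)) (esymm (Fin (Γ.label e)) ℤ i) =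
        eval (fun j => X (M.seq c j)) F := by
  obtain ⟨W, hW⟩ := M.edgePoly e
  -- Vieta: in ∏ (t - x_a) the coefficient of t^(ℓ(e) - i) is (-1)^i e_i.
  refine ⟨(-1) ^ i * W.coeff (Γ.label e - i), fun c => ?_⟩
  set f := (c.1 e).orderEmbOfFin (c.2.card_eq e) with hf
  have h1 : ∏ a ∈ c.1 e, (Polynomial.X - Polynomial.C (X a)) =
      (∏ j : Fin (Γ.label e), (Polynomial.X - Polynomial.C (X j : MvPolynomial _ ℤ))).map
        (rename f : MvPolynomial (Fin (Γ.label e)) ℤ →ₐ[ℤ]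
          MvPolynomial (Fin Γ.level) ℤ).toRingHom := by
    conv_lhs => rw [← Finset.map_orderEmbOfFin_univ (c.1 e) (c.2.card_eq e), Finset.prod_map]
    rw [Polynomial.map_prod]
    refine Finset.prod_congr rfl fun j _ => ?_
    simp [hf]
  have h2 : (∏ j : Fin (Γ.label e),
      (Polynomial.X - Polynomial.C (X j : MvPolynomial _ ℤ))).coeff (Γ.label e - i) =
        (-1) ^ i * esymm (Fin (Γ.label e)) ℤ i := by
    have h3 := Multiset.prod_X_sub_C_coeff
      ((Finset.univ : Finset (Fin (Γ.label e))).val.map fun j => (X j : MvPolynomial _ ℤ))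
      (k := Γ.label e - i) (by simp)
    rw [Multiset.map_map] at h3
    simp only [Multiset.card_map, Finset.card_val, Finset.card_univ, Fintype.card_fin,
      show Γ.label e - (Γ.label e - i) = i by omega] at h3
    rw [MvPolynomial.esymm_eq_multiset_esymm]
    exact h3
  have h4 := congrArg (fun p => Polynomial.coeff p (Γ.label e - i)) ((hW c).trans h1)
  simp only [Polynomial.coeff_map, h2] at h4
  rw [map_mul, map_pow, map_neg, map_one, h4]
  change rename f _ = (-1) ^ i * rename f ((-1) ^ i * _)
  rw [map_mul, map_pow, map_neg, map_one, ← mul_assoc, ← mul_pow]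
  simp

/-- Elementary symmetric polynomials generate all symmetric ones, so it suffices to represent them.
-/
theorem exists_eval_eq_substitute (e : Γ.Edge)
    (p : symmetricSubalgebra (Fin (Γ.label e)) ℤ) :
    ∃ F : MvPolynomial (Fin (ℓ + 1)) (MvPolynomial (Fin Γ.level) ℤ), ∀ c : Γ.Coloring,
      c.substitute ℤ e p = eval (fun j => X (M.seq c j)) F := by
  obtain ⟨q, rfl⟩ := esymmAlgHom_fin_surjective ℤ (le_refl (Γ.label e)) p
  induction q using MvPolynomial.induction_on with
  | C a =>
    refine ⟨C (C a), fun c => ?_⟩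
    rw [eval_C]
    exact ((c.substitute ℤ e).comp (esymmAlgHom _ ℤ _)).commutes a
  | add q r hq hr =>
    obtain ⟨F, hF⟩ := hq
    obtain ⟨G, hG⟩ := hr
    exact ⟨F + G, fun c => by rw [map_add, map_add, map_add, hF, hG]⟩
  | mul_X q i hq =>
    obtain ⟨F, hF⟩ := hq
    obtain ⟨G, hG⟩ := M.exists_eval_eq_esymm e (i + 1) (by omega)
    refine ⟨F * G, fun c => ?_⟩
    rw [map_mul, map_mul, map_mul, hF, ← hG]
    congr 1
    simp [Coloring.substitute, esymmAlgHom]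

theorem exists_represents (x : Γ.DecoratedSpace ℤ) : ∃ F, M.Represents x F := by
  induction x using DecoratedSpace.induction with
  | tprod a p =>
    choose F hF using fun e => M.exists_eval_eq_substitute e (p e)
    refine ⟨C (C a) * ∏ e, F e, (represents_algebraMap a).mul fun c => ?_⟩
    rw [map_prod]
    refine (c.numerator_tprod p).trans ?_
    exact Finset.prod_congr rfl fun e _ => hF e c
  | add x y hx hy =>
    obtain ⟨F, hF⟩ := hx
    obtain ⟨G, hG⟩ := hy
    exact ⟨F + G, hF.add hG⟩

variable {M} {x : Γ.DecoratedSpace ℤ}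
  {F : MvPolynomial (Fin (ℓ + 1)) (MvPolynomial (Fin Γ.level) ℤ)}

theorem Represents.hasConstant (h : M.Represents x F) :
    HasConstant (evalRat ℤ x) (M.sign * chainForm ℓ k (map constantCoeff F)) := by
  have h1 := (HasConstant.of_poly (σ := Fin Γ.level) (C (M.sign : ℤ))).mul
    (hasConstant_sum_eval (S := Finset.univ) (by simpa using M.level_eq) F)
  rw [constantCoeff_C] at h1
  convert h1 using 1
  rw [evalRat, Finset.mul_sum]
  refine Finset.sum_bij (fun c _ => M.seq c)
    (fun c _ => mem_injSeq.2 ⟨M.injective_seq c, fun _ => Finset.mem_univ _⟩)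
    (fun c _ c' _ hcc => M.seq_injective hcc) (fun b hb => ?_) (fun c _ => ?_)
  · obtain ⟨c, hc⟩ := M.exists_seq b (mem_injSeq.1 hb).1
    exact ⟨c, Finset.mem_univ _, hc⟩
  · rw [h c, M.denominator_eq c]
    -- The sign moves from denominator to numerator because ±1 is its own inverse.
    rcases Int.units_eq_one_or M.sign with hs | hs
    · simp [hs]
    · simp [hs, div_neg]

theorem Represents.evalVanishes_iff (h : M.Represents x F) :
    EvalVanishes ℤ x ↔ chainForm ℓ k (map constantCoeff F) = 0 := by
  have h1 := h.hasConstant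
  constructor
  · intro h2
    have h3 := h1.unique h2
    simpa using h3
  · intro h2
    rw [h2, mul_zero] at h1
    exact h1

/-- The exponents which are `u j` on the strand `j` and `0` on all other edges. -/
def strandExponent (M : ChainModel Γ ℓ k) (u : Fin (ℓ + 1) → ℕ) (e : Γ.Edge) : ℕ :=
  ∑ j, if M.strand j = e then u j else 0

theorem strandExponent_strand (u : Fin (ℓ + 1) → ℕ) (j : Fin (ℓ + 1)) :
    M.strandExponent u (M.strand j) = u j := by
  simp [strandExponent, M.strand_injective.eq_iff]

theorem strandExponent_of_ne (u : Fin (ℓ + 1) → ℕ) {e : Γ.Edge} (he : ∀ j, e ≠ M.strand j) :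
    M.strandExponent u e = 0 :=
  Finset.sum_eq_zero fun j _ => if_neg fun h => he j h.symm

theorem represents_strandExponent (u : Fin (ℓ + 1) → ℕ) :
    M.Represents (monomialDecoration (M.strandExponent u)).toSpace (∏ j, X j ^ u j) := by
  intro c
  rw [Coloring.numerator_monomialDecoration, map_prod,
    ← Finset.prod_subset (Finset.subset_univ (Finset.univ.image M.strand)),
    Finset.prod_image M.strand_injective.injOn]
  · refine Finset.prod_congr rfl fun j _ => ?_
    rw [M.color_strand, Finset.prod_singleton, strandExponent_strand, map_pow, eval_X]
  · intro e _ he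
    have he' : ∀ j, e ≠ M.strand j := by
      rintro j rfl
      exact he (Finset.mem_image_of_mem _ (Finset.mem_univ j))
    simp [strandExponent_of_ne u he']

/-- Monomial decorations of the strands already give all test monomials in y; conversely every
decoration is represented by some polynomial. -/
theorem Represents.forall_evalVanishes_iff (h : M.Represents x F) :
    (∀ g : Γ.Decoration ℤ, EvalVanishes ℤ (x * g.toSpace)) ↔
      map constantCoeff F ∈ formRadical (chainForm ℓ k) := by
  constructor
  · intro hx g
    induction g using MvPolynomial.induction_on' with
    | add p q hp hq => rw [mul_add, map_add, hp, hq, add_zero]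
    | monomial u a =>
      have h1 := (h.mul (represents_strandExponent u)).evalVanishes_iff.1 (hx _)
      have h2 : monomial u a = a • ∏ j, (X j : MvPolynomial (Fin (ℓ + 1)) ℤ) ^ u j := by
        rw [monomial_eq, Finsupp.prod_fintype _ _ (by simp), smul_eq_C_mul]
      rw [h2, mul_smul_comm, map_smul]
      simp only [map_mul, map_prod, map_pow, map_X] at h1
      rw [h1, smul_zero]
  · intro hF g
    obtain ⟨G, hG⟩ := M.exists_represents g.toSpace
    rw [(h.mul hG).evalVanishes_iff, map_mul]
    exact hF _

/-- `Represents` translates the pairing conditions into membership in the radical of `chainForm`,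
where the d.u.r. monomials are known to be a basis. -/
theorem isDurGraph (M : ChainModel Γ ℓ k) : Γ.IsDurGraph ℤ := by
  let u : Fin (k + 1) × (Fin ℓ → Fin 2) → Fin (ℓ + 1) → ℕ :=
    fun t => Fin.cons (t.1 : ℕ) fun j => (t.2 j : ℕ)
  have hu : Function.Injective u := by
    intro s t hst
    have h1 := congrFun hst 0
    have h2 := fun j : Fin ℓ => congrFun hst j.succ
    simp only [u, Fin.cons_zero, Fin.cons_succ] at h1 h2
    exact Prod.ext (Fin.ext h1) (funext fun j => Fin.ext (h2 j))
  let D : Fin (k + 1) × (Fin ℓ → Fin 2) → Γ.Decoration ℤ :=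
    fun t => monomialDecoration (M.strandExponent (u t))
  have hbasis := isBasisModRadical_chainForm ℓ k
  have hrep : ∀ c : Fin (k + 1) × (Fin ℓ → Fin 2) → ℤ, ∃ F,
      M.Represents (∑ t, algebraMap ℤ _ (c t) * (D t).toSpace) F ∧ map constantCoeff F =
        ∑ t, c t • (X 0 ^ (t.1 : ℕ) * ∏ j : Fin ℓ, X j.succ ^ (t.2 j : ℕ)) := by
    intro c
    refine ⟨_, Represents.sum fun t _ =>
      (represents_algebraMap (c t)).mul (represents_strandExponent (u t)), ?_⟩
    rw [map_sum]
    refine Finset.sum_congr rfl fun t _ => ?_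
    simp [u, Fin.prod_univ_succ, smul_eq_C_mul]
  refine isDurGraph_of_forall (fun x => ?_) D ?_ ?_ (fun c hc => ?_) (fun x => ?_)
  · obtain ⟨F, hF⟩ := M.exists_represents x
    obtain ⟨q, hq, -⟩ := hF.hasConstant
    exact ⟨q, hq⟩
  · ext d
    rw [mem_dur_iff M.label_splitRight]
    constructor
    · rintro ⟨t, rfl⟩
      have h := (M.dur_exponents (M.strandExponent (u t))).2
        ⟨⟨?_, fun j => ?_⟩, fun e he => strandExponent_of_ne _ he⟩
      · exact ⟨_, h.1, h.2, rfl⟩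
      · rw [strandExponent_strand]
        simp only [u, Fin.cons_zero]
        omega
      · rw [strandExponent_strand]
        simp only [u, Fin.cons_succ]
        omega
    · rintro ⟨ε, h1, h2, rfl⟩
      obtain ⟨⟨h3, h4⟩, h5⟩ := (M.dur_exponents ε).1 ⟨h1, h2⟩
      refine ⟨(⟨ε (M.strand 0), by omega⟩, fun j => ⟨ε (M.strand j.succ), by
        have := h4 j
        omega⟩), ?_⟩
      change monomialDecoration _ = _
      congr 1
      funext e
      by_cases he : ∃ j, e = M.strand j
      · obtain ⟨j, rfl⟩ := he
        rw [strandExponent_strand]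
        refine Fin.cases ?_ (fun i => ?_) j <;> simp [u]
      · push Not at he
        rw [strandExponent_of_ne _ he, h5 e he]
  · intro s t hst
    have h1 := monomialDecoration_injective hst
    refine hu (funext fun j => ?_)
    have h2 := congrFun h1 (M.strand j)
    rwa [strandExponent_strand, strandExponent_strand] at h2
  · obtain ⟨F, hF, hF'⟩ := hrep c
    rw [hF.forall_evalVanishes_iff, hF'] at hc
    exact hbasis.eq_zero_of_sum_mem hc
  · obtain ⟨F, hF⟩ := M.exists_represents x
    obtain ⟨c, hc⟩ := hbasis.exists_sub_mem (map constantCoeff F)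
    obtain ⟨G, hG, hG'⟩ := hrep c
    refine ⟨c, (hF.sub hG).forall_evalVanishes_iff.2 ?_⟩
    rwa [map_sub, hG']

end ChainModel

end

end VinylGraph

namespace VinylGraph

noncomputable section

open MvPolynomial

/-! ### Colorings of the chain of dumbbells -/

section Chain

variable {k : ℕ} {hk : 0 < k} {ℓ : ℕ}

theorem chainData_mergeLeft_succ (i : Fin ℓ) :
    (chainData ℓ).mergeLeft i.succ = .right i.castSucc := rfl

theorem chainData_mergeRight_last :
    (chainData ℓ).mergeRight (Fin.last ℓ) = .right (Fin.last ℓ) := by simp [chainData]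

theorem chainData_mergeRight_castSucc (i : Fin ℓ) :
    (chainData ℓ).mergeRight i.castSucc = .left i.succ := by simp [chainData]

/-- In a coloring of the chain, each dumbbell preserves the colors of its strands. -/
theorem chain_color_mergeLeft (c : (chain k hk ℓ).Coloring) (j : Fin (ℓ + 1)) :
    c.1 ((chainData ℓ).mergeLeft j) = c.1 (.left j) := by
  induction j using Fin.induction with
  | zero => rfl
  | succ i ih =>
    have h1 : c.1 (.thick i.castSucc) = c.1 (.left i.castSucc) ∪ c.1 (.right i.castSucc) :=
      c.2.split i.castSucc
    have h2 : c.1 (.thick i.castSucc) = c.1 ((chainData ℓ).mergeLeft i.castSucc) ∪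
      c.1 ((chainData ℓ).mergeRight i.castSucc) := c.2.merge i.castSucc
    have h3 : Disjoint (c.1 (.left i.castSucc)) (c.1 (.right i.castSucc)) :=
      c.disjoint_split i.castSucc
    have h4 : Disjoint (c.1 ((chainData ℓ).mergeLeft i.castSucc))
        (c.1 ((chainData ℓ).mergeRight i.castSucc)) := by
      rw [← Finset.card_union_eq_card_add_card, ← h2, c.2.card_eq, c.2.card_eq, c.2.card_eq]
      exact (chain k hk ℓ).label_merge i.castSucc
    rw [chainData_mergeRight_castSucc, ih] at h2 h4
    rw [chainData_mergeLeft_succ]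
    rw [h1] at h2
    -- Removing the common left colors from the two decompositions of the thick edge leaves the
    -- right edge on one side and the left edge of the next dumbbell on the other.
    rw [← Finset.union_sdiff_cancel_left h3, h2, Finset.union_sdiff_cancel_left h4]

theorem chain_color_left_succ (c : (chain k hk ℓ).Coloring) (i : Fin ℓ) :
    c.1 (.left i.succ) = c.1 (.right i.castSucc) :=
  (chain_color_mergeLeft c i.succ).symm

/-- The colors of the right edges of the split vertices. -/
def chainSeq (c : (chain k hk ℓ).Coloring) (j : Fin (ℓ + 1)) : Fin (k + ℓ + 1) :=
  (Finset.card_eq_one.1 (c.2.card_eq (.right j))).choose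

theorem chain_color_right (c : (chain k hk ℓ).Coloring) (j : Fin (ℓ + 1)) :
    c.1 (.right j) = {chainSeq c j} :=
  (Finset.card_eq_one.1 (c.2.card_eq (.right j))).choose_spec

theorem chain_card_left_zero (c : (chain k hk ℓ).Coloring) : (c.1 (.left 0)).card = k := by
  rw [c.2.card_eq]; rfl

theorem chain_cover (c : (chain k hk ℓ).Coloring) (a : Fin (k + ℓ + 1)) :
    a ∈ c.1 (.left 0) ∪ Finset.univ.image (chainSeq c) := by
  obtain ⟨e, he, hae⟩ := c.2.cover a
  have he' : e ∈ chainBase ℓ := he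
  simp only [chainBase, List.mem_append, List.mem_map, List.mem_finRange, true_and,
    List.mem_singleton] at he'
  rw [Finset.mem_union, Finset.mem_image]
  rcases he' with ⟨j, rfl⟩ | rfl
  · revert hae
    refine Fin.cases (fun h => Or.inl h) (fun i h => Or.inr ⟨i.castSucc, Finset.mem_univ _, ?_⟩) j
    rw [chain_color_left_succ, chain_color_right, Finset.mem_singleton] at h
    exact h.symm
  · rw [chain_color_right, Finset.mem_singleton] at hae
    exact Or.inr ⟨_, Finset.mem_univ _, hae.symm⟩

/-- All k + ℓ + 1 colors are covered and strand 0 has only k of them, so the sequence takes at least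
ℓ + 1 values. -/
theorem chainSeq_injective (c : (chain k hk ℓ).Coloring) : Function.Injective (chainSeq c) := by
  have h1 : (Finset.univ : Finset (Fin (k + ℓ + 1))) ⊆
      c.1 (.left 0) ∪ Finset.univ.image (chainSeq c) := fun a _ => chain_cover c a
  have h2 := (Finset.card_le_card h1).trans (Finset.card_union_le _ _)
  rw [chain_card_left_zero, Finset.card_fin] at h2
  have h3 : (Finset.univ.image (chainSeq c)).card = (Finset.univ : Finset (Fin (ℓ + 1))).card := by
    refine le_antisymm Finset.card_image_le ?_
    rw [Finset.card_fin]
    omega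
  have h4 := Finset.card_image_iff.1 h3
  rwa [Finset.coe_univ, Set.injOn_univ] at h4

theorem chain_color_left_zero (c : (chain k hk ℓ).Coloring) :
    c.1 (.left 0) = Finset.univ \ Finset.univ.image (chainSeq c) := by
  symm
  refine Finset.eq_of_subset_of_card_le (fun a ha => ?_) ?_
  · exact (Finset.mem_union.1 (chain_cover c a)).resolve_right (Finset.mem_sdiff.1 ha).2
  · rw [chain_card_left_zero, Finset.card_sdiff_of_subset (Finset.subset_univ _),
      Finset.card_image_of_injective _ (chainSeq_injective c), Finset.card_fin, Finset.card_fin]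
    omega

theorem chain_color_thick (c : (chain k hk ℓ).Coloring) (j : Fin (ℓ + 1)) :
    c.1 (.thick j) = c.1 (.left j) ∪ c.1 (.right j) := c.2.split j

/-- The coloring with given colors of the right edges of the split vertices. -/
def seqColor (b : Fin (ℓ + 1) → Fin (k + ℓ + 1)) : ChainEdge ℓ → Finset (Fin (k + ℓ + 1))
  | .left j => Fin.cases (Finset.univ \ Finset.univ.image b) (fun i => {b i.castSucc}) j
  | .right j => {b j}
  | .thick j => Fin.cases (Finset.univ \ Finset.univ.image b) (fun i => {b i.castSucc}) j ∪ {b j}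

theorem card_univ_sdiff_image {b : Fin (ℓ + 1) → Fin (k + ℓ + 1)} (hb : Function.Injective b) :
    (Finset.univ \ Finset.univ.image b).card = k := by
  rw [Finset.card_sdiff_of_subset (Finset.subset_univ _), Finset.card_image_of_injective _ hb,
    Finset.card_fin, Finset.card_fin]
  omega

theorem seqColor_isColoring (hk : 0 < k) {b : Fin (ℓ + 1) → Fin (k + ℓ + 1)}
    (hb : Function.Injective b) : (chain k hk ℓ).IsColoring (seqColor b) where
  card_eq e := by
    rcases e with j | j | j
    · refine Fin.cases ?_ (fun i => ?_) j
      · change (Finset.univ \ Finset.univ.image b ∪ {b 0}).card = k + 1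
        rw [Finset.card_union_of_disjoint (by simp), card_univ_sdiff_image hb,
          Finset.card_singleton]
      · change ({b i.castSucc} ∪ {b i.succ} : Finset (Fin (k + ℓ + 1))).card =
          if i.succ = 0 then k + 1 else 2
        rw [if_neg (Fin.succ_ne_zero i), Finset.card_union_of_disjoint]
        · simp
        · rw [Finset.disjoint_singleton]
          exact hb.ne i.castSucc_lt_succ.ne
    · refine Fin.cases ?_ (fun i => ?_) j
      · exact card_univ_sdiff_image hb
      · change ({b i.castSucc} : Finset (Fin (k + ℓ + 1))).card = if i.succ = 0 then k else 1
        rw [if_neg (Fin.succ_ne_zero i), Finset.card_singleton]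
    · exact Finset.card_singleton _
  split j := rfl
  merge j := by
    change seqColor b (.left j) ∪ {b j} =
      seqColor b ((chainData ℓ).mergeLeft j) ∪ seqColor b ((chainData ℓ).mergeRight j)
    congr 1
    · refine Fin.cases ?_ (fun i => ?_) j <;> rfl
    · refine Fin.lastCases ?_ (fun i => ?_) j
      · rw [chainData_mergeRight_last]; rfl
      · rw [chainData_mergeRight_castSucc]; rfl
  cover a := by
    have hmem : ∀ j : Fin (ℓ + 1), ChainEdge.left j ∈ chainBase ℓ := fun j => by simp [chainBase]
    by_cases ha : a ∈ Finset.univ.image b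
    · obtain ⟨j, -, rfl⟩ := Finset.mem_image.1 ha
      refine Fin.lastCases ?_ (fun i => ?_) j
      · exact ⟨.right (Fin.last ℓ), by simp [chainBase], Finset.mem_singleton_self _⟩
      · exact ⟨.left i.succ, hmem _, Finset.mem_singleton_self (b i.castSucc)⟩
    · exact ⟨.left 0, hmem _, Finset.mem_sdiff.2 ⟨Finset.mem_univ _, ha⟩⟩

theorem chain_coloring_ext {c c' : (chain k hk ℓ).Coloring} (h : chainSeq c = chainSeq c') :
    c = c' := by
  have hr : ∀ j, c.1 (.right j) = c'.1 (.right j) := fun j => by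
    rw [chain_color_right, chain_color_right, h]
  have hl : ∀ j, c.1 (.left j) = c'.1 (.left j) := fun j => by
    refine Fin.cases ?_ (fun i => ?_) j
    · rw [chain_color_left_zero, chain_color_left_zero, h]
    · rw [chain_color_left_succ, chain_color_left_succ, hr]
  refine Subtype.ext (funext fun e => ?_)
  rcases e with j | j | j
  · rw [chain_color_thick, chain_color_thick, hl, hr]
  · exact hl j
  · exact hr j

/-- Only strand 0 needs care: its colors are those missing from the sequence, so `complementPoly`
serves. Thick edges give products. -/
theorem chain_exists_edgePoly (e : ChainEdge ℓ) :
    ∃ W : Polynomial (MvPolynomial (Fin (ℓ + 1)) (MvPolynomial (Fin (k + ℓ + 1)) ℤ)),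
      ∀ c : (chain k hk ℓ).Coloring, W.map (eval fun j => X (chainSeq c j)) =
        ∏ a ∈ c.1 e, (Polynomial.X - Polynomial.C (X a)) := by
  have hright : ∀ j : Fin (ℓ + 1), ∀ c : (chain k hk ℓ).Coloring,
      (Polynomial.X - Polynomial.C (X j) :
        Polynomial (MvPolynomial (Fin (ℓ + 1)) (MvPolynomial (Fin (k + ℓ + 1)) ℤ))).map
          (eval fun j => X (chainSeq c j)) =
        ∏ a ∈ c.1 (.right j), (Polynomial.X - Polynomial.C (X a)) := by
    intro j c
    rw [chain_color_right, Finset.prod_singleton]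
    simp
  have hleft : ∀ j : Fin (ℓ + 1),
      ∃ W : Polynomial (MvPolynomial (Fin (ℓ + 1)) (MvPolynomial (Fin (k + ℓ + 1)) ℤ)),
      ∀ c : (chain k hk ℓ).Coloring, W.map (eval fun j => X (chainSeq c j)) =
        ∏ a ∈ c.1 (.left j), (Polynomial.X - Polynomial.C (X a)) := by
    intro j
    refine Fin.cases ?_ (fun i => ?_) j
    · refine ⟨complementPoly (Fin (k + ℓ + 1)) ℓ, fun c => ?_⟩
      rw [map_complementPoly (chainSeq_injective c), chain_color_left_zero]
    · refine ⟨Polynomial.X - Polynomial.C (X i.castSucc), fun c => ?_⟩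
      rw [chain_color_left_succ]
      exact hright i.castSucc c
  rcases e with j | j | j
  · obtain ⟨W, hW⟩ := hleft j
    refine ⟨W * (Polynomial.X - Polynomial.C (X j)), fun c => ?_⟩
    have hd : Disjoint (c.1 (.left j)) (c.1 (.right j)) := c.disjoint_split j
    rw [Polynomial.map_mul, hW, hright, chain_color_thick, Finset.prod_union hd]
  · exact hleft j
  · exact ⟨_, hright j⟩

/-- Strand 0 lies to the left, so its k factors are x_a - x_{b_0}, opposite to those of `chainSum`;
hence the sign (-1)^k. -/
theorem chain_denominator (c : (chain k hk ℓ).Coloring) :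
    algebraMap (MvPolynomial (Fin (k + ℓ + 1)) ℤ)
      (FractionRing (MvPolynomial (Fin (k + ℓ + 1)) ℤ)) (c.denominator ℤ) =
      ((((-1) ^ k : ℤˣ) : ℤ) : FractionRing (MvPolynomial (Fin (k + ℓ + 1)) ℤ)) *
        ((∏ a ∈ Finset.univ \ Finset.univ.image (chainSeq c),
          (ratVar (chainSeq c 0) - ratVar a)) * seqDenominator (chainSeq c)) := by
  have h : c.denominator ℤ = ∏ v : Fin (ℓ + 1), ∏ i ∈ c.1 (.left v), ∏ j ∈ c.1 (.right v),
      (X i - X j) := rfl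
  rw [h, Fin.prod_univ_succ, chain_color_left_zero, map_mul, ← mul_assoc]
  congr 1
  · have h1 : ∀ a : Fin (k + ℓ + 1), algebraMap (MvPolynomial (Fin (k + ℓ + 1)) ℤ)
        (FractionRing (MvPolynomial (Fin (k + ℓ + 1)) ℤ))
          (∏ j ∈ c.1 (.right 0), (X a - X j)) = -1 * (ratVar (chainSeq c 0) - ratVar a) := by
      intro a
      rw [chain_color_right, Finset.prod_singleton, map_sub]
      simp only [ratVar]
      ring
    rw [map_prod, Finset.prod_congr rfl fun a _ => h1 a, Finset.prod_mul_distrib,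
      Finset.prod_const, card_univ_sdiff_image (chainSeq_injective c)]
    simp
  · rw [map_prod, seqDenominator]
    refine Finset.prod_congr rfl fun i _ => ?_
    rw [chain_color_left_succ, chain_color_right, chain_color_right, Finset.prod_singleton,
      Finset.prod_singleton, map_sub]
    rfl

variable (k ℓ) in
/-- The colorings of the chain of dumbbells. -/
def chainModel (hk : 0 < k) : ChainModel (chain k hk ℓ) ℓ k where
  level_eq := by simp only; omega
  strand := .right
  strand_injective := fun a b h => ChainEdge.right.inj h
  seq := chainSeq
  seq_injective := fun _ _ h => chain_coloring_ext h
  injective_seq := chainSeq_injective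
  exists_seq b hb := by
    refine ⟨⟨seqColor b, seqColor_isColoring hk hb⟩, funext fun j => ?_⟩
    have h := chain_color_right (⟨seqColor b, seqColor_isColoring hk hb⟩ : (chain k hk ℓ).Coloring) j
    exact (Finset.singleton_injective h).symm
  color_strand := chain_color_right
  edgePoly := chain_exists_edgePoly
  sign := (-1) ^ k
  denominator_eq := chain_denominator
  label_splitRight _ := rfl
  dur_exponents ε := by
    refine and_congr ?_ Iff.rfl
    change (∀ v : Fin (ℓ + 1), ε (.right v) ≤ chainLabel k ℓ (.left v)) ↔ _
    -- The bound is the label of the left edge: k at dumbbell 0, and 1 at all others.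
    rw [Fin.forall_fin_succ]
    refine and_congr Iff.rfl (forall_congr' fun j => ?_)
    rw [chainLabel, if_neg (Fin.succ_ne_zero j)]

end Chain

/-! ### Colorings of the circle -/

theorem circle_color (c : circle.Coloring) : c.1 () = {0} := by
  obtain ⟨a, ha⟩ := Finset.card_eq_one.1 (c.2.card_eq ())
  rw [ha, Fin.fin_one_eq_zero a]

/-- The coloring of the circle. -/
def circleModel : ChainModel circle 0 0 where
  level_eq := rfl
  strand _ := ()
  strand_injective _ _ _ := Subsingleton.elim (α := Fin 1) _ _
  seq _ _ := (0 : Fin 1)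
  seq_injective c c' _ := Subtype.ext (funext fun _ => (circle_color c).trans (circle_color c').symm)
  injective_seq _ _ _ _ := Subsingleton.elim (α := Fin 1) _ _
  exists_seq b _ := by
    refine ⟨⟨fun _ => Finset.univ, ⟨fun _ => rfl, fun v => v.elim, fun v => v.elim,
      fun i => ⟨(), List.mem_singleton.2 rfl, Finset.mem_univ i⟩⟩⟩, funext fun j => ?_⟩
    exact (Fin.fin_one_eq_zero (b j)).symm
  color_strand c _ := circle_color c
  edgePoly e := ⟨Polynomial.X - Polynomial.C (X 0), fun c => by
    rw [show c.1 e = {0} from circle_color c, Finset.prod_singleton]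
    simp⟩
  sign := 1
  denominator_eq c := by
    have h : c.denominator ℤ = 1 := Finset.prod_of_isEmpty _
    have h2 : (Finset.univ : Finset (Fin 1)) \
        Finset.univ.image (fun _ : Fin 1 => (0 : Fin 1)) = ∅ := rfl
    rw [h]
    erw [h2]
    simp [seqDenominator]
  label_splitRight v := v.elim
  dur_exponents ε := by
    constructor
    · rintro ⟨-, h⟩
      exact ⟨⟨(h () fun v => v.elim).le, fun j => j.elim0⟩, fun e _ => h e fun v => v.elim⟩
    · rintro ⟨⟨h, -⟩, -⟩
      exact ⟨fun v => v.elim, fun e _ => Nat.le_zero.1 h⟩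

/-- Apart from the circle, a staircase on strands of label 1 is a chain with k = 1 and one dumbbell
less in the index. -/
theorem theta_isDurGraph (ℓ : ℕ) : (Theta ℓ).IsDurGraph ℤ := by
  cases ℓ with
  | zero => exact circleModel.isDurGraph
  | succ ℓ => exact (chainModel 1 ℓ Nat.one_pos).isDurGraph

theorem gamma_isDurGraph (k ℓ : ℕ) : (Gamma k ℓ).IsDurGraph ℤ := by
  cases k with
  | zero => exact theta_isDurGraph ℓ
  | succ k => exact (chainModel (k + 1) ℓ k.succ_pos).isDurGraph

end

end VinylGraph

theorem mainTheorem2 :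
    (∀ k ℓ : ℕ, (VinylGraph.Gamma k ℓ).IsDurGraph ℤ) ∧
      ∀ ℓ : ℕ, (VinylGraph.Theta ℓ).IsDurGraph ℤ :=
  ⟨VinylGraph.gamma_isDurGraph, VinylGraph.theta_isDurGraph⟩
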